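/- Let $G=(\mathbb C^*)^k\times SL_2(\mathbb C)$ and let $V=\bigoplus_{i=1}^s V_{\chi_i,n_i}$, where $\chi_i\in\mathbb Z^k$ is a character of the torus $(\mathbb C^*)^k$, $n_i\ge 0$ is an integer, and $V_{\chi_i,n_i}$ is the space of binary forms $f(x,y)$ of degree $n_i$ over $\mathbb C$ with the action $$\left(t,\begin{pmatrix}\kappa&\lambda\\ \mu&\nu\end{pmatrix}\right)f(x,y)=\chi_i(t)\,f(\kappa x+\mu y,\lambda x+\nu y).$$ (Every finite-dimensional rational $G$-module is isomorphic to such a $V$.) Let $v=(v_1,\dots,v_s)\in V$ be nonzero, let $\langle v\rangle$ be the corresponding point of $\mathbb P(V)$, and let $S=\{i: v_i\ne 0\}$. For $i\in S$ and $a\in\mathbb C$ let $e_i(a)$ be the multiplicity of the linear form $ax+y$ as a factor of $v_i$, and put $\chi_i'=(\chi_i,n_i)\in\mathbb Q^{k+1}$. Let $C\subset\mathbb Q^{k+1}$ be the convex hull of the points $\chi_i'$, $i\in S$. A nonempty (possibly improper) face $F$ of $C$ is called admissible if there is a vector $R=(r_1,\dots,r_k,p)\in\mathbb Q^{k+1}$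 with $p<0$ such that $R$ is orthogonal to the affine span of $F$, $R$ is not orthogonal to any face of $C$ strictly containing $F$, and $R$ is directed into $C$, that is, $\langle w-u,R\rangle\ge 0$ for all $u\in F$ and $w\in C$. For such a face put $J=\{i\in S:\chi_i'\in F\}$. Theorem. The Zariski closure of the orbit $G\langle v\rangle$ in $\mathbb P(V)$ contains only finitely many $G$-orbits if and only if, for every admissible face $F$ of $C$ whose dimension is maximal among the admissible faces of $C$, and for every integer vector $\beta=(\beta_i)_{i\in J}$ with $\sum_{i\in J}\beta_i\chi_i=0$ and $\sum_{i\in J}\beta_i=0$, one has $$\sum_{i\in J}e_i(a)\,\beta_i=0\qquad\text{for all } a\in\mathbb C.$$ -/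

import Mathlib

open MvPolynomial
open scoped LinearAlgebra.Projectivization

namespace TorusSL2

noncomputable section

/-! ### The group, its modules, and the projective action -/

/-- The group `G = (ℂ^*)^k × SL₂(ℂ)`. -/
abbrev Grp (k : ℕ) : Type := (Fin k → ℂˣ) × Matrix.SpecialLinearGroup (Fin 2) ℂ

/-- The value at `t` of the character `t ↦ t₁^{c₁} ⋯ t_k^{c_k}` of the torus `(ℂ^*)^k`. -/
def charVal {k : ℕ} (c : Fin k → ℤ) (t : Fin k → ℂˣ) : ℂˣ := ∏ j, t j ^ c j

/-- The substitution `f(x, y) ↦ f(κ x + μ y, l x + ν y)` attached to the matrix with rows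
`(κ, l)` and `(μ, ν)`; here `x = X 0` and `y = X 1`. -/
def subst (g : Matrix (Fin 2) (Fin 2) ℂ) :
    MvPolynomial (Fin 2) ℂ →ₐ[ℂ] MvPolynomial (Fin 2) ℂ :=
  aeval fun b => C (g 0 b) * X 0 + C (g 1 b) * X 1

theorem subst_one : subst 1 = AlgHom.id ℂ _ := by
  ext b
  fin_cases b <;> simp [subst]

theorem subst_mul (g h : Matrix (Fin 2) (Fin 2) ℂ) :
    subst (g * h) = (subst g).comp (subst h) := by
  ext1 b
  simp only [subst, aeval_X, AlgHom.comp_apply, map_add, map_mul, Matrix.mul_apply,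
    Fin.sum_univ_two, algHom_C, algebraMap_eq]
  ring

theorem subst_isHomogeneous (g : Matrix (Fin 2) (Fin 2) ℂ) {m : ℕ} {f : MvPolynomial (Fin 2) ℂ}
    (hf : f.IsHomogeneous m) : (subst g f).IsHomogeneous m := by
  have h := hf.aeval (n := 1)
    (fun b => (C (g 0 b) * X 0 + C (g 1 b) * X 1 : MvPolynomial (Fin 2) ℂ))
    (fun b => (isHomogeneous_C_mul_X _ _).add (isHomogeneous_C_mul_X _ _))
  rwa [one_mul] at h

/-- The `G`-module `V = ⨁ᵢ V_{χᵢ, nᵢ}` (`i = 1, …, s`): the `i`-th component of a vector is a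
binary form of degree `n i`. The characters `χ` enter through the action of `G`. -/
def Mod {k s : ℕ} (_χ : Fin s → Fin k → ℤ) (n : Fin s → ℕ) : Type :=
  (i : Fin s) → homogeneousSubmodule (Fin 2) ℂ (n i)

variable {k s : ℕ} {χ : Fin s → Fin k → ℤ} {n : Fin s → ℕ}

instance : AddCommGroup (Mod χ n) :=
  inferInstanceAs (AddCommGroup ((i : Fin s) → homogeneousSubmodule (Fin 2) ℂ (n i)))

instance : Module ℂ (Mod χ n) :=
  inferInstanceAs (Module ℂ ((i : Fin s) → homogeneousSubmodule (Fin 2) ℂ (n i)))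

/-- The `i`-th component of a vector of `V`, as a polynomial in `x` and `y`. -/
def comp (v : Mod χ n) (i : Fin s) : MvPolynomial (Fin 2) ℂ := (v i).1

theorem ext_comp {v w : Mod χ n} (h : ∀ i, comp v i = comp w i) : v = w :=
  funext fun i => Subtype.ext (h i)

theorem comp_add (v w : Mod χ n) (i : Fin s) : comp (v + w) i = comp v i + comp w i := rfl

theorem comp_zero (i : Fin s) : comp (0 : Mod χ n) i = 0 := rfl

theorem comp_smul (c : ℂ) (v : Mod χ n) (i : Fin s) : comp (c • v) i = c • comp v i := rfl

/-- `(t, g)` sends the `i`-th component `f(x, y)` to `χᵢ(t) f(κ x + μ y, l x + ν y)`. -/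
instance : SMul (Grp k) (Mod χ n) where
  smul g v i := ⟨(charVal (χ i) g.1 : ℂ) • subst g.2.1 (comp v i),
    Submodule.smul_mem _ _ (subst_isHomogeneous _ (v i).2)⟩

theorem comp_grp_smul (g : Grp k) (v : Mod χ n) (i : Fin s) :
    comp (g • v) i = (charVal (χ i) g.1 : ℂ) • subst g.2.1 (comp v i) := rfl

instance : DistribMulAction (Grp k) (Mod χ n) where
  one_smul v := ext_comp fun i => by
    simp [comp_grp_smul, charVal, subst_one]
  mul_smul g h v := ext_comp fun i => by
    simp [comp_grp_smul, charVal, subst_mul, mul_zpow, Finset.prod_mul_distrib, mul_smul]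
  smul_zero g := ext_comp fun i => by simp [comp_grp_smul, comp_zero]
  smul_add g v w := ext_comp fun i => by simp [comp_grp_smul, comp_add]

/-- `G` acts linearly on `V`; hence it acts on `ℙ ℂ V` (Mathlib's instance). -/
instance : SMulCommClass (Grp k) ℂ (Mod χ n) where
  smul_comm g c v := ext_comp fun i => by
    simp only [comp_grp_smul, comp_smul, map_smul]
    exact smul_comm _ _ _

/-! ### The Zariski closure in a projective space -/

/-- The Zariski closure of a subset of `ℙ(V)`: the common zeros of all homogeneous polynomial
functions on `V` that vanish on the subset. A polynomial function on `V` is a polynomial in the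
linear functionals on `V`; the vanishing of a homogeneous one at a point of `ℙ(V)` does not
depend on the representative of the point. -/
def zariskiClosure {V : Type*} [AddCommGroup V] [Module ℂ V] (S : Set (ℙ ℂ V)) : Set (ℙ ℂ V) :=
  {P | ∀ (d : ℕ) (f : MvPolynomial (Module.Dual ℂ V) ℂ), f.IsHomogeneous d →
    (∀ Q ∈ S, eval (fun φ : Module.Dual ℂ V => φ Q.rep) f = 0) →
      eval (fun φ : Module.Dual ℂ V => φ P.rep) f = 0}

/-! ### The polyhedron and its admissible faces -/

/-- The standard scalar product on `ℚ^{k+1} = ℚ^k × ℚ`. -/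
def scal (u R : (Fin k → ℚ) × ℚ) : ℚ := ∑ j, u.1 j * R.1 j + u.2 * R.2

/-- The point `χ'ᵢ = (χᵢ, nᵢ)` of `ℚ^{k+1}`. -/
def charPoint (χ : Fin s → Fin k → ℤ) (n : Fin s → ℕ) (i : Fin s) : (Fin k → ℚ) × ℚ :=
  (fun j => (χ i j : ℚ), (n i : ℚ))

/-- The polyhedron `C` of a vector `v`: the convex hull of the points `χ'ᵢ` that belong to the
nonzero components of `v`. -/
def polyhedron (v : Mod χ n) : Set ((Fin k → ℚ) × ℚ) :=
  convexHull ℚ {u | ∃ i, comp v i ≠ 0 ∧ u = charPoint χ n i}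

/-- `F` is a (nonempty, possibly improper) face of the convex set `K`. -/
def IsFace (K F : Set ((Fin k → ℚ) × ℚ)) : Prop :=
  F.Nonempty ∧ Convex ℚ F ∧ IsExtreme ℚ K F

/-- The vector `R` is orthogonal to the affine face `F`. -/
def Orthogonal (R : (Fin k → ℚ) × ℚ) (F : Set ((Fin k → ℚ) × ℚ)) : Prop :=
  ∀ u ∈ F, ∀ w ∈ F, scal (u - w) R = 0

/-- The face `F` of `K` is admissible: there is a vector `R = (r₁, …, r_k, p)` with `p < 0` that
is orthogonal to `F`, not orthogonal to any larger face, and directed from `F` into `K`. -/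
def IsAdmissible (K F : Set ((Fin k → ℚ) × ℚ)) : Prop :=
  IsFace K F ∧ ∃ R : (Fin k → ℚ) × ℚ, R.2 < 0 ∧ Orthogonal R F ∧
    (∀ F', IsFace K F' → F ⊂ F' → ¬ Orthogonal R F') ∧
    ∀ u ∈ F, ∀ w ∈ K, 0 ≤ scal (w - u) R

/-- The dimension of (the affine span of) a set. -/
def faceDim (F : Set ((Fin k → ℚ) × ℚ)) : ℕ := Module.finrank ℚ (vectorSpan ℚ F)

/-- `F` is an admissible face of `K` whose dimension is maximal among the admissible faces. -/
def IsMaxAdmissible (K F : Set ((Fin k → ℚ) × ℚ)) : Prop :=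
  IsAdmissible K F ∧ ∀ F', IsAdmissible K F' → faceDim F' ≤ faceDim F

open Classical in
/-- The set `J` of the indices of those characteristic points of `v` that lie in the face `F`. -/
def faceIndices (v : Mod χ n) (F : Set ((Fin k → ℚ) × ℚ)) : Finset (Fin s) :=
  {i | comp v i ≠ 0 ∧ charPoint χ n i ∈ F}

/-- The multiplicity `eᵢ(a)` of the linear factor `a x + y` in the `i`-th component of `v`
(used only for nonzero components). -/
def mult (v : Mod χ n) (i : Fin s) (a : ℂ) : ℕ := multiplicity (C a * X 0 + X 1) (comp v i)

end

end TorusSL2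

/-!
A point `⟨w⟩` of the closure is studied as a limit of points `c · (t, g) v`, where `c` is a scalar.
Valuations make this precise: the closure condition says that an ultraproduct `K` of copies of `ℂ`
contains such `c`, `t`, `g` and has a `ℂ`-valued place (`Place`) at which the coordinates of
`c · (t, g) v` are finite with values those of `w` (`exists_place`, which rests on the extension
theorem for places `Place.exists_of_subalgebra`). So "limit" below means "value at the place".

*Necessity* (`sum_mult_eq_zero_of_finite`). An admissible face `F` is the set of minima of
`⟨·, R⟩` for some `R = (r, p)` with `p < 0`. After the substitution `y ↦ z x + y`, the one-parameter
subgroup with exponents `R` degenerates `⟨v⟩` to the vector `faceLimit v J z` with components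
`v i (1, z) x ^ n i`, `i ∈ J`. If there are finitely many orbits, then infinitely many `z` give
points of one orbit. A relation `∑ β i = 0`, `∑ β i χ i = 0` on `J` implies `∑ β i n i = 0`, as
`p ≠ 0`; hence `∏ v i (1, z) ^ β i` is constant on an orbit. This rational function of `z` is then
constant, so all its orders `∑ e i (a) β i` are zero.

*Sufficiency* (`orbits_finite`). Left multiplication by matrices over the valuation ring moves `w`
only inside its orbit, and reduces `g` to one of three forms (`reduces_one_or_isNormal`): the
identity, or `!![κ, 0; 0, κ⁻¹]` or `!![κ, κ ε; 0, κ⁻¹]` times a matrix over `ℂ` that moves a point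
`o` of the projective line to `(1 : 0)`; here `κ` is infinite, `ε` is infinitesimal and `κ² ε` is
infinite. In each case the components of `w` are `γ i q i`, where `q` depends on `v`, `o` and the
case only, and `γ i` is the limit of a monomial in `c`, `t`, `κ`, `ε`. The nonzero `γ i` satisfy all
multiplicative relations among the exponents, because a power of `ε` with a finite nonzero value is
the zeroth power. As `ℂ^*` is divisible, the `γ i` are the values of characters at a point of
the torus (`exists_torus_point`). Therefore the orbit of `⟨w⟩` is determined by `o`, the case, and
the set of indices with `q i ≠ 0` and `γ i ≠ 0` (`mem_orbit_restrict`).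

This leaves finitely many orbits for the finitely many `o` that are the point at infinity or a zero
of a component of `v`. For the other points `o = (1 : z)` the components of `w` are
`γ i v i (1, z) x ^ n i`, where `γ i` is the limit of `c χ i (t) κ ^ n i`. The valuations of `c`, `t`,
`κ` solve, in the value group, a system of linear inequalities which says that the indices with
`γ i ≠ 0` lie on a common admissible face. Replacing the solution by one with more equalities and
then by a rational one makes the dimension of this face maximal (`exists_tight_solution`,
`exists_rational_majorant`, `exists_isMaxAdmissible_of_lim`). On this face the hypothesis makes the
products `∏ v i (1, z) ^ β i` independent of `z`, so all these `z` together give finitely many orbits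
(`mem_orbit_of_generic`).
-/

/-! ### Places with residue field `ℂ` -/

/-- A `ℂ`-valued place of a field `K ⊇ ℂ`, recorded by its graph: `(x, a)` belongs to the graph
when `x` is finite at the place and takes the value `a` there. Every element or its inverse is
finite. -/
structure Place (K : Type*) [Field K] [Algebra ℂ K] where
  graph : Subalgebra ℂ (K × ℂ)
  eq_zero_of_mem : ∀ a, ((0 : K), a) ∈ graph → a = 0
  exists_or : ∀ x : K, (∃ a, (x, a) ∈ graph) ∨ (x⁻¹, (0 : ℂ)) ∈ graph

namespace Place

section Existence

variable {K : Type*} [Field K] [Algebra ℂ K]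

/-- A graph of a partial function cannot be enlarged by `(x, a)` for two reasons only: `(x, a)`
is in it, or some polynomial relation of `x` over the domain is violated by `a`. -/
theorem mem_of_maximal {G : Subalgebra ℂ (K × ℂ)}
    (hG : Maximal (fun G : Subalgebra ℂ (K × ℂ) => ∀ a, ((0 : K), a) ∈ G → a = 0) G)
    {x : K} {a : ℂ}
    (h : ∀ p : Polynomial G,
      p.eval₂ ((RingHom.fst K ℂ).comp G.val.toRingHom) x = 0 →
      p.eval₂ ((RingHom.snd K ℂ).comp G.val.toRingHom) a = 0) : (x, a) ∈ G := by
  let ψ : Polynomial G →ₐ[ℂ] K × ℂ :=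
    { Polynomial.eval₂RingHom G.val.toRingHom (x, a) with
      commutes' := fun r => by
        rw [Polynomial.algebraMap_apply]
        simp }
  have hψ : ∀ p, ψ p = p.eval₂ G.val.toRingHom (x, a) := fun p => rfl
  have h1 : ∀ p, (ψ p).1 = p.eval₂ ((RingHom.fst K ℂ).comp G.val.toRingHom) x := fun p => by
    rw [hψ, ← RingHom.coe_fst, Polynomial.hom_eval₂]; rfl
  have h2 : ∀ p, (ψ p).2 = p.eval₂ ((RingHom.snd K ℂ).comp G.val.toRingHom) a := fun p => by
    rw [hψ, ← RingHom.coe_snd, Polynomial.hom_eval₂]; rfl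
  have hle : G ≤ ψ.range := fun y hy => ⟨Polynomial.C ⟨y, hy⟩, by simp [hψ]⟩
  have hP : ∀ b, ((0 : K), b) ∈ ψ.range → b = 0 := by
    rintro b ⟨p, hp⟩
    have hp' : ψ p = (0, b) := hp
    have e1 := h1 p
    have e2 := h2 p
    rw [hp'] at e1 e2
    exact e2.trans (h p e1.symm)
  exact hG.2 hP hle ⟨Polynomial.X, by simp [hψ]⟩

/-- The extension theorem for places. A maximal graph is local; a valuation ring that dominates
its domain cannot be larger than the domain. -/
theorem exists_of_subalgebra (G₀ : Subalgebra ℂ (K × ℂ))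
    (h₀ : ∀ a, ((0 : K), a) ∈ G₀ → a = 0) : ∃ p : Place K, G₀ ≤ p.graph := by
  obtain ⟨G, hle, hG⟩ := zorn_le_nonempty₀
    {G : Subalgebra ℂ (K × ℂ) | ∀ a, ((0 : K), a) ∈ G → a = 0} (fun c hc hchain y hy => by
      refine ⟨sSup c, ?_, fun z hz => le_sSup hz⟩
      intro a ha
      have : Nonempty c := ⟨⟨y, hy⟩⟩
      rw [sSup_eq_iSup', ← SetLike.mem_coe,
        Subalgebra.coe_iSup_of_directed hchain.directed] at ha
      simp only [Set.mem_iUnion] at ha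
      obtain ⟨z, hza⟩ := ha
      exact hc z.2 a hza) G₀ h₀
  have hG' : Maximal (fun G : Subalgebra ℂ (K × ℂ) => ∀ a, ((0 : K), a) ∈ G → a = 0) G := hG
  have hinv : ∀ x a, (x, a) ∈ G → a ≠ 0 → (x⁻¹, a⁻¹) ∈ G := by
    intro x a hx ha
    have hx0 : x ≠ 0 := by
      rintro rfl
      exact ha (hG.1 a hx)
    refine mem_of_maximal hG' fun p hp => ?_
    have e1 : p.reverse.eval₂ ((RingHom.fst K ℂ).comp G.val.toRingHom) x = 0 := by
      let _ : Invertible x⁻¹ := invertibleOfNonzero (inv_ne_zero hx0)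
      have := (Polynomial.eval₂_reverse_eq_zero_iff
        ((RingHom.fst K ℂ).comp G.val.toRingHom) x⁻¹ p).2 hp
      simpa using this
    have e2 : p.reverse.eval₂ ((RingHom.snd K ℂ).comp G.val.toRingHom) a = 0 := by
      have hxa : ((RingHom.fst K ℂ).comp G.val.toRingHom) ⟨(x, a), hx⟩ = x := rfl
      have hxa' : ((RingHom.snd K ℂ).comp G.val.toRingHom) ⟨(x, a), hx⟩ = a := rfl
      have h1 := Polynomial.hom_eval₂ p.reverse (RingHom.id G)
        ((RingHom.fst K ℂ).comp G.val.toRingHom) ⟨(x, a), hx⟩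
      have h2 := Polynomial.hom_eval₂ p.reverse (RingHom.id G)
        ((RingHom.snd K ℂ).comp G.val.toRingHom) ⟨(x, a), hx⟩
      rw [RingHom.comp_id, hxa, e1] at h1
      rw [RingHom.comp_id, hxa'] at h2
      rw [← h2]
      refine hG.1 _ ?_
      rw [← h1]
      exact (p.reverse.eval₂ (RingHom.id G) ⟨(x, a), hx⟩).2
    let _ : Invertible a⁻¹ := invertibleOfNonzero (inv_ne_zero ha)
    refine (Polynomial.eval₂_reverse_eq_zero_iff
        ((RingHom.snd K ℂ).comp G.val.toRingHom) a⁻¹ p).1 ?_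
    simpa using e2
  -- the ring `G` is local, with maximal ideal the kernel of the second projection
  let f : G →+* K := (RingHom.fst K ℂ).comp G.val.toRingHom
  let g : G →+* ℂ := (RingHom.snd K ℂ).comp G.val.toRingHom
  have hfg : ∀ y : G, (f y, g y) ∈ G := fun y => y.2
  have hloc : IsLocalHom g := ⟨fun y hy => by
    have hy0 : g y ≠ 0 := hy.ne_zero
    have hf0 : f y ≠ 0 := by
      intro h
      have := hfg y
      rw [h] at this
      exact hy0 (hG.1 _ this)
    refine IsUnit.of_mul_eq_one ⟨((f y)⁻¹, (g y)⁻¹), hinv _ _ (hfg y) hy0⟩ ?_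
    exact Subtype.ext (Prod.ext (mul_inv_cancel₀ hf0) (mul_inv_cancel₀ hy0))⟩
  have hlocal : IsLocalRing G := RingHom.domain_isLocalRing g
  obtain ⟨V, hV, hVloc⟩ := (LocalSubring.range f).exists_le_valuationSubring
  have hfV : ∀ y : G, f y ∈ V := fun y => hV ⟨y, rfl⟩
  -- elements of the maximal ideal of `G` are not invertible in `V`
  have hnonunit : ∀ y : G, g y = 0 → V.valuation (f y) < 1 := by
    intro y hy
    refine (V.valuation_lt_one_iff ⟨f y, hfV y⟩).1 ?_
    by_contra hmax
    have hu : IsUnit (⟨f y, hfV y⟩ : V) := by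
      by_contra hnu
      exact hmax ((IsLocalRing.mem_maximalIdeal _).2 hnu)
    have hu' : IsUnit (⟨f y, y, rfl⟩ : (LocalSubring.range f).toSubring) := hVloc.map_nonunit _ hu
    obtain ⟨⟨_, z, rfl⟩, hz⟩ := isUnit_iff_exists_inv.1 hu'
    have hz' : f y * f z = 1 := congrArg Subtype.val hz
    have h1 := hfg (y * z - 1)
    rw [map_sub, map_sub, map_mul, map_mul, hz', hy, map_one, map_one, sub_self] at h1
    simpa using hG.1 _ h1
  have hdom : ∀ x ∈ V, ∃ a, (x, a) ∈ G := by
    intro x hx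
    -- the values at the place of all polynomials that vanish at `x`
    let I : Ideal (Polynomial ℂ) :=
      (RingHom.ker (Polynomial.eval₂RingHom f x)).map (Polynomial.mapRingHom g)
    have hsurj : Function.Surjective (Polynomial.mapRingHom g) :=
      Polynomial.map_surjective g fun c => ⟨algebraMap ℂ G c, rfl⟩
    have hI : I ≠ ⊤ := by
      intro htop
      have h1 : (1 : Polynomial ℂ) ∈ I := htop ▸ trivial
      obtain ⟨p, hp, hp1⟩ := (Ideal.mem_map_iff_of_surjective _ hsurj).1 h1
      have hlt : V.valuation ((p - 1).eval₂ f x) < 1 := by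
        rw [Polynomial.eval₂_eq_sum, Polynomial.sum]
        refine Valuation.map_sum_lt _ one_ne_zero fun j _ => ?_
        rw [map_mul, map_pow]
        have hj : g ((p - 1).coeff j) = 0 := by
          rw [← Polynomial.coeff_map, Polynomial.map_sub, Polynomial.map_one,
            ← Polynomial.coe_mapRingHom, hp1, sub_self, Polynomial.coeff_zero]
        exact mul_lt_one_of_lt_of_le (hnonunit _ hj)
          (pow_le_one₀ zero_le ((V.valuation_le_one_iff x).2 hx))
      have hp0 : p.eval₂ f x = 0 := hp
      rw [Polynomial.eval₂_sub, hp0, Polynomial.eval₂_one, zero_sub, Valuation.map_neg,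
        map_one] at hlt
      exact lt_irrefl _ hlt
    obtain ⟨q, hq⟩ : ∃ q, I = Ideal.span {q} := (IsPrincipalIdealRing.principal I).principal
    have hdeg : q.degree ≠ 0 := by
      intro h0
      exact hI (hq.trans (Ideal.span_singleton_eq_top.2 (Polynomial.isUnit_iff_degree_eq_zero.2 h0)))
    obtain ⟨a, ha⟩ := IsAlgClosed.exists_root q hdeg
    refine ⟨a, mem_of_maximal hG' fun p hp => ?_⟩
    have hmem : Polynomial.mapRingHom g p ∈ I := Ideal.mem_map_of_mem _ hp
    rw [hq, Ideal.mem_span_singleton] at hmem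
    have := (Polynomial.IsRoot.dvd ha hmem)
    rw [← Polynomial.eval_map]
    exact this
  refine ⟨⟨G, hG.1, fun x => ?_⟩, hle⟩
  by_cases hx : x ∈ V
  · exact Or.inl (hdom x hx)
  · right
    obtain ⟨b, hb⟩ := hdom x⁻¹ ((V.mem_or_inv_mem x).resolve_left hx)
    by_cases hb0 : b = 0
    · rwa [hb0] at hb
    · have := hinv _ _ hb hb0
      rw [inv_inv] at this
      exact absurd (hfV ⟨_, this⟩) hx

end Existence

section Limits

variable {K : Type*} [Field K] [Algebra ℂ K] (p : Place K)

/-- `p.Lim x a`: the element `x` is finite at the place `p` and has the value `a` there. -/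
def Lim (x : K) (a : ℂ) : Prop := (x, a) ∈ p.graph

variable {p} {x y : K} {a b : ℂ}

theorem Lim.add (hx : p.Lim x a) (hy : p.Lim y b) : p.Lim (x + y) (a + b) :=
  p.graph.add_mem hx hy

theorem Lim.neg (hx : p.Lim x a) : p.Lim (-x) (-a) := p.graph.neg_mem hx

theorem Lim.mul (hx : p.Lim x a) (hy : p.Lim y b) : p.Lim (x * y) (a * b) :=
  p.graph.mul_mem hx hy

theorem Lim.pow (hx : p.Lim x a) (m : ℕ) : p.Lim (x ^ m) (a ^ m) := p.graph.pow_mem hx m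

variable (p) in
theorem lim_algebraMap (a : ℂ) : p.Lim (algebraMap ℂ K a) a := p.graph.algebraMap_mem a

variable (p) in
theorem lim_zero : p.Lim 0 0 := p.graph.zero_mem

variable (p) in
theorem lim_one : p.Lim 1 1 := p.graph.one_mem

theorem Lim.unique (h : p.Lim x a) (h' : p.Lim x b) : a = b := by
  have := h.add h'.neg
  rw [add_neg_cancel] at this
  exact sub_eq_zero.1 (by simpa [sub_eq_add_neg] using p.eq_zero_of_mem _ this)

theorem Lim.ne_zero (h : p.Lim x a) (ha : a ≠ 0) : x ≠ 0 := by
  rintro rfl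
  exact ha (h.unique (lim_zero p))

variable (p) in
theorem lim_or_inv (x : K) : (∃ a, p.Lim x a) ∨ p.Lim x⁻¹ 0 := p.exists_or x

theorem not_lim_of_inv (hx : x ≠ 0) (h : p.Lim x⁻¹ 0) : ¬ p.Lim x a := fun h' => by
  have := h.mul h'
  rw [inv_mul_cancel₀ hx, zero_mul] at this
  exact one_ne_zero ((lim_one p).unique this)

theorem Lim.inv (h : p.Lim x a) (ha : a ≠ 0) : p.Lim x⁻¹ a⁻¹ := by
  have hx := h.ne_zero ha
  rcases lim_or_inv p x⁻¹ with ⟨b, hb⟩ | h0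
  · have := h.mul hb
    rw [mul_inv_cancel₀ hx] at this
    rwa [← eq_inv_of_mul_eq_one_right ((lim_one p).unique this).symm]
  · rw [inv_inv] at h0
    exact absurd (h.unique h0) ha

theorem Lim.zpow (h : p.Lim x a) (ha : a ≠ 0) (m : ℤ) : p.Lim (x ^ m) (a ^ m) := by
  cases m with
  | ofNat m => simpa using h.pow m
  | negSucc m => simpa [zpow_negSucc] using (h.pow (m + 1)).inv (pow_ne_zero _ ha)

theorem Lim.prod {ι : Type*} (s : Finset ι) {f : ι → K} {g : ι → ℂ}
    (h : ∀ i ∈ s, p.Lim (f i) (g i)) : p.Lim (∏ i ∈ s, f i) (∏ i ∈ s, g i) := by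
  induction s using Finset.cons_induction with
  | empty => simpa using lim_one p
  | cons i s hi ih =>
    rw [Finset.prod_cons, Finset.prod_cons]
    exact (h i (Finset.mem_cons_self i s)).mul (ih fun j hj => h j (Finset.mem_cons_of_mem hj))

variable (p) in
/-- The valuation ring of a place. -/
def valuationSubring : ValuationSubring K where
  carrier := {x | ∃ a, p.Lim x a}
  mul_mem' := fun ⟨_, ha⟩ ⟨_, hb⟩ => ⟨_, ha.mul hb⟩
  one_mem' := ⟨1, lim_one p⟩
  add_mem' := fun ⟨_, ha⟩ ⟨_, hb⟩ => ⟨_, ha.add hb⟩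
  zero_mem' := ⟨0, lim_zero p⟩
  neg_mem' := fun ⟨_, ha⟩ => ⟨_, ha.neg⟩
  mem_or_inv_mem' := fun x => (lim_or_inv p x).imp id fun h => ⟨0, h⟩

/-- The two-variable polynomial `P` over `K` has finite coefficients, and their values at the place
are the coefficients of `Q`; this is witnessed by a polynomial over the graph. -/
def LimPoly (p : Place K) (P : MvPolynomial (Fin 2) K) (Q : MvPolynomial (Fin 2) ℂ) : Prop :=
  ∃ S : MvPolynomial (Fin 2) p.graph,
    MvPolynomial.map ((RingHom.fst K ℂ).comp p.graph.val.toRingHom) S = P ∧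
    MvPolynomial.map ((RingHom.snd K ℂ).comp p.graph.val.toRingHom) S = Q

variable {P P' : MvPolynomial (Fin 2) K} {Q Q' : MvPolynomial (Fin 2) ℂ}

theorem LimPoly.coeff (h : p.LimPoly P Q) (m : Fin 2 →₀ ℕ) :
    p.Lim (coeff m P) (coeff m Q) := by
  obtain ⟨S, rfl, rfl⟩ := h
  rw [coeff_map, coeff_map]
  exact (MvPolynomial.coeff m S).2

theorem limPoly_of_coeff (h : ∀ m, p.Lim (coeff m P) (coeff m Q)) : p.LimPoly P Q := by
  classical
  refine ⟨∑ m ∈ P.support ∪ Q.support, monomial m ⟨(MvPolynomial.coeff m P,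
    MvPolynomial.coeff m Q), h m⟩, ?_, ?_⟩
  · rw [map_sum]
    simp only [map_monomial]
    conv_rhs => rw [P.as_sum]
    refine (Finset.sum_subset Finset.subset_union_left fun m _ hm => ?_).symm
    exact (congrArg (monomial m) (notMem_support_iff.1 hm)).trans monomial_zero
  · rw [map_sum]
    simp only [map_monomial]
    conv_rhs => rw [Q.as_sum]
    refine (Finset.sum_subset Finset.subset_union_right fun m _ hm => ?_).symm
    exact (congrArg (monomial m) (notMem_support_iff.1 hm)).trans monomial_zero

theorem LimPoly.mul (h : p.LimPoly P Q) (h' : p.LimPoly P' Q') : p.LimPoly (P * P') (Q * Q') := by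
  obtain ⟨S, rfl, rfl⟩ := h
  obtain ⟨S', rfl, rfl⟩ := h'
  exact ⟨S * S', map_mul _ _ _, map_mul _ _ _⟩

theorem LimPoly.add (h : p.LimPoly P Q) (h' : p.LimPoly P' Q') : p.LimPoly (P + P') (Q + Q') := by
  obtain ⟨S, rfl, rfl⟩ := h
  obtain ⟨S', rfl, rfl⟩ := h'
  exact ⟨S + S', map_add _ _ _, map_add _ _ _⟩

theorem LimPoly.pow (h : p.LimPoly P Q) (m : ℕ) : p.LimPoly (P ^ m) (Q ^ m) := by
  obtain ⟨S, rfl, rfl⟩ := h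
  exact ⟨S ^ m, map_pow _ _ _, map_pow _ _ _⟩

theorem limPoly_C (h : p.Lim x a) : p.LimPoly (C x) (C a) :=
  ⟨C ⟨(x, a), h⟩, map_C _ _, map_C _ _⟩

variable (p) in
theorem limPoly_X (b : Fin 2) : p.LimPoly (X b) (X b) := ⟨X b, map_X _ _, map_X _ _⟩

variable (p) in
theorem limPoly_map (F : MvPolynomial (Fin 2) ℂ) :
    p.LimPoly (MvPolynomial.map (algebraMap ℂ K) F) F :=
  limPoly_of_coeff fun m => by
    rw [coeff_map]
    exact lim_algebraMap p _

theorem LimPoly.unique (h : p.LimPoly P Q) (h' : p.LimPoly P Q') : Q = Q' :=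
  MvPolynomial.ext _ _ fun m => (h.coeff m).unique (h'.coeff m)

/-- If `P` has the nonzero value `Q` and a multiple `c P` is finite, then `c` is finite. -/
theorem LimPoly.exists_of_C_mul {c : K} (h' : p.LimPoly (C c * P) Q') (h : p.LimPoly P Q)
    (hQ : Q ≠ 0) : ∃ γ, p.Lim c γ ∧ Q' = C γ * Q := by
  obtain ⟨m, hm⟩ := MvPolynomial.ne_zero_iff.1 hQ
  have h1 := (h'.coeff m).mul ((h.coeff m).inv hm)
  rw [coeff_C_mul, mul_assoc, mul_inv_cancel₀ ((h.coeff m).ne_zero hm), mul_one] at h1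
  exact ⟨_, h1, h'.unique ((limPoly_C h1).mul h)⟩

end Limits

end Place

/-! ### Characters of tori -/

/-- A family of nonzero complex numbers that satisfies every multiplicative relation that the
characters `m i` satisfy is the family of their values at a point of the torus: the group `ℂ^*`
is divisible, hence injective. -/
theorem exists_torus_point {ι N : Type*} [Fintype N] (J : Finset ι) (m : ι → N → ℤ)
    (γ : ι → ℂˣ)
    (h : ∀ β : ι → ℤ, (∀ l, ∑ i ∈ J, β i * m i l = 0) → ∏ i ∈ J, γ i ^ β i = 1) :
    ∃ τ : N → ℂˣ, ∀ i ∈ J, γ i = ∏ l, τ l ^ m i l := by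
  classical
  have hdiv : DivisibleBy (Additive ℂˣ) ℤ := by
    have : DivisibleBy (Additive ℂˣ) ℕ := by
      refine divisibleByOfSMulRightSurj (Additive ℂˣ) ℕ fun {d} hd a => ?_
      obtain ⟨z, hz⟩ := IsAlgClosed.exists_pow_nat_eq ((a.toMul : ℂˣ) : ℂ) (Nat.pos_of_ne_zero hd)
      have hz0 : z ≠ 0 := by
        rintro rfl
        rw [zero_pow hd] at hz
        exact a.toMul.ne_zero hz.symm
      exact ⟨Additive.ofMul (Units.mk0 z hz0), Additive.toMul.injective (Units.ext (by simpa using hz))⟩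
    exact AddGroup.divisibleByIntOfDivisibleByNat _
  let f : (J → ℤ) →ₗ[ℤ] (N → ℤ) := Fintype.linearCombination ℤ fun i : J => m i
  let g : (J → ℤ) →ₗ[ℤ] Additive ℂˣ :=
    Fintype.linearCombination ℤ fun i : J => Additive.ofMul (γ i)
  have hker : LinearMap.ker f ≤ LinearMap.ker g := by
    intro β hβ
    have hβ' : ∀ l, ∑ i : J, β i * m i l = 0 := fun l => by
      have := congrFun (LinearMap.mem_ker.1 hβ) l
      simpa [f, Fintype.linearCombination_apply] using this
    have := h (fun i => if hi : i ∈ J then β ⟨i, hi⟩ else 0) fun l => by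
      rw [← hβ' l, ← Finset.sum_coe_sort J]
      exact Finset.sum_congr rfl fun i _ => by simp
    rw [LinearMap.mem_ker]
    apply Additive.toMul.injective
    rw [← Finset.prod_coe_sort J] at this
    rw [toMul_zero, ← this]
    simp [g, Fintype.linearCombination_apply, toMul_sum]
  let g' : LinearMap.range f →ₗ[ℤ] Additive ℂˣ :=
    (LinearMap.ker f).liftQ g hker ∘ₗ f.quotKerEquivRange.symm.toLinearMap
  obtain ⟨F, hF⟩ := (Module.Baer.of_divisible (Additive ℂˣ)).extension_property
    (LinearMap.range f).subtype (LinearMap.range f).injective_subtype g'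
  have hFf : ∀ β, F (f β) = g β := fun β => by
    have : F (f β) = g' ⟨f β, β, rfl⟩ := LinearMap.congr_fun hF ⟨f β, β, rfl⟩
    rw [this]
    simp only [g', LinearMap.comp_apply, LinearEquiv.coe_coe]
    have h1 : f.quotKerEquivRange.symm ⟨f β, β, rfl⟩ = (LinearMap.ker f).mkQ β := by
      rw [LinearEquiv.symm_apply_eq]
      rfl
    rw [h1, Submodule.mkQ_apply, Submodule.liftQ_apply]
  refine ⟨fun l => (F (Pi.single l 1)).toMul, fun i hi => ?_⟩
  have h1 : f (Pi.single ⟨i, hi⟩ 1) = m i := by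
    simp [f, Fintype.linearCombination_apply_single]
  have h2 : g (Pi.single ⟨i, hi⟩ 1) = Additive.ofMul (γ i) := by
    simp [g, Fintype.linearCombination_apply_single]
  have h3 := hFf (Pi.single ⟨i, hi⟩ 1)
  rw [h1, h2] at h3
  have h4 : m i = ∑ l, m i l • (Pi.single l 1 : N → ℤ) := by
    exact pi_eq_sum_univ' (m i)
  rw [h4, map_sum] at h3
  apply_fun Additive.toMul at h3
  rw [toMul_ofMul, toMul_sum] at h3
  rw [← h3]
  refine Finset.prod_congr rfl fun l _ => ?_
  rw [map_zsmul, toMul_zsmul]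

/-! ### Linear inequalities over an ordered group -/

theorem exists_common_denominator {ι : Type*} [Fintype ι] (q : ι → ℚ) :
    ∃ (d : ℤ) (b : ι → ℤ), 0 < d ∧ ∀ i, (b i : ℚ) = d * q i := by
  classical
  refine ⟨∏ i, ((q i).den : ℤ), fun i => (∏ j ∈ Finset.univ.erase i, ((q j).den : ℤ)) * (q i).num,
    Finset.prod_pos fun i _ => by exact_mod_cast (q i).den_pos, fun i => ?_⟩
  rw [← Finset.prod_erase_mul _ _ (Finset.mem_univ i)]
  push_cast
  rw [mul_assoc, mul_comm ((q i).den : ℚ), Rat.mul_den_eq_num]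

section Majorant

variable {Γ : Type*} [AddCommGroup Γ] [LinearOrder Γ] [IsOrderedAddMonoid Γ]
  {ι N : Type*} [Fintype N]

/-- A solution of the inequalities `∑ a i l • r l + n i • p ≤ 0` with `p > 0` can be moved, without
losing an equality, until the vectors `a i` of the equalities span all the `a i`: as long as a
linear form vanishes on the former and not on the latter, add to the solution the largest multiple
of this form that keeps the inequalities. To stay inside `Γ` everything is multiplied by
integers. -/
theorem exists_tight_solution (S : Finset ι) (a : ι → N → ℤ) (n : ι → ℤ) (r : N → Γ) (p : Γ)
    (hp : 0 < p) (h : ∀ i ∈ S, ∑ l, a i l • r l + n i • p ≤ 0) :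
    ∃ (r' : N → Γ) (p' : Γ), 0 < p' ∧ (∀ i ∈ S, ∑ l, a i l • r' l + n i • p' ≤ 0) ∧
      (∀ i ∈ S, ∑ l, a i l • r l + n i • p = 0 → ∑ l, a i l • r' l + n i • p' = 0) ∧
      ∀ M : N → ℤ, (∀ i ∈ S, ∑ l, a i l • r' l + n i • p' = 0 → ∑ l, M l * a i l = 0) →
        ∀ i ∈ S, ∑ l, M l * a i l = 0 := by
  classical
  induction hc : (S.filter fun i => ∑ l, a i l • r l + n i • p ≠ 0).card using
    Nat.strong_induction_on generalizing r p with
  | _ c ih =>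
  by_cases hM : ∀ M : N → ℤ, (∀ i ∈ S, ∑ l, a i l • r l + n i • p = 0 → ∑ l, M l * a i l = 0) →
      ∀ i ∈ S, ∑ l, M l * a i l = 0
  · exact ⟨r, p, hp, h, fun i _ hi => hi, hM⟩
  push Not at hM
  obtain ⟨M, hM0, hM1⟩ : ∃ M : N → ℤ,
      (∀ i ∈ S, ∑ l, a i l • r l + n i • p = 0 → ∑ l, M l * a i l = 0) ∧
      ∃ i ∈ S, 0 < ∑ l, M l * a i l := by
    obtain ⟨M, hM0, i, hi, hMi⟩ := hM
    rcases lt_or_gt_of_ne hMi with hlt | hgt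
    · refine ⟨-M, fun j hj hj' => ?_, i, hi, ?_⟩
      · simpa using hM0 j hj hj'
      · simpa using hlt
    · exact ⟨M, hM0, i, hi, hgt⟩
  set H : ι → Γ := fun i => ∑ l, a i l • r l + n i • p with hH
  set m : ι → ℤ := fun i => ∑ l, M l * a i l with hm
  let Sp := S.filter fun i => 0 < m i
  have hSp : Sp.Nonempty := by
    obtain ⟨i, hi, hi'⟩ := hM1
    exact ⟨i, Finset.mem_filter.2 ⟨hi, hi'⟩⟩
  -- `i₀` minimizes the ratio `-H i / m i`
  obtain ⟨i₀, hi₀, hmin⟩ := Finset.exists_min_image Sp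
    (fun i => (∏ j ∈ Sp.erase i, m j) • (-H i)) hSp
  have hi₀S := (Finset.mem_filter.1 hi₀).1
  have hm₀ : 0 < m i₀ := (Finset.mem_filter.1 hi₀).2
  have hratio : ∀ i ∈ Sp, m i₀ • H i ≤ m i • H i₀ := by
    intro i hi
    by_cases hii : i = i₀
    · rw [hii]
    have hD : 0 < ∏ j ∈ (Sp.erase i).erase i₀, m j :=
      Finset.prod_pos fun j hj => (Finset.mem_filter.1 (Finset.mem_of_mem_erase
        (Finset.mem_of_mem_erase hj))).2
    have h1 := hmin i hi
    rw [← Finset.prod_erase_mul (Sp.erase i) m (Finset.mem_erase.2 ⟨Ne.symm hii, hi₀⟩),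
      ← Finset.prod_erase_mul (Sp.erase i₀) m (Finset.mem_erase.2 ⟨hii, hi⟩),
      Finset.erase_right_comm, mul_smul, mul_smul] at h1
    have h2 := le_of_smul_le_smul_of_pos_left h1 hD
    rw [smul_neg, smul_neg] at h2
    exact neg_le_neg_iff.1 h2
  have hnew : ∀ i, ∑ l, a i l • (m i₀ • r l - M l • H i₀) + n i • (m i₀ • p) =
      m i₀ • H i - m i • H i₀ := by
    intro i
    have e1 : ∑ l, a i l • m i₀ • r l = m i₀ • ∑ l, a i l • r l := by
      rw [Finset.smul_sum]
      exact Finset.sum_congr rfl fun l _ => smul_comm _ _ _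
    have e2 : ∑ l, a i l • M l • H i₀ = m i • H i₀ := by
      rw [hm, Finset.sum_smul]
      exact Finset.sum_congr rfl fun l _ => by rw [smul_smul, mul_comm]
    simp only [smul_sub, Finset.sum_sub_distrib]
    rw [e1, e2, smul_comm (n i), sub_add_eq_add_sub, ← smul_add]
  have hlt : (S.filter fun i => ∑ l, a i l • (m i₀ • r l - M l • H i₀) +
      n i • (m i₀ • p) ≠ 0).card < c := by
    rw [← hc]
    refine Finset.card_lt_card ⟨fun i hi => ?_, fun hsub => ?_⟩
    · rw [Finset.mem_filter] at hi ⊢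
      refine ⟨hi.1, fun hi0 => hi.2 ?_⟩
      have e1 : H i = 0 := hi0
      have e2 : m i = 0 := hM0 i hi.1 hi0
      rw [hnew, e1, e2, smul_zero, zero_smul, sub_zero]
    · have : i₀ ∈ S.filter fun i => ∑ l, a i l • r l + n i • p ≠ 0 :=
        Finset.mem_filter.2 ⟨hi₀S, fun hi0 => hm₀.ne' (hM0 i₀ hi₀S hi0)⟩
      refine (Finset.mem_filter.1 (hsub this)).2 ?_
      rw [hnew, sub_self]
  have hle : ∀ i ∈ S, ∑ l, a i l • (m i₀ • r l - M l • H i₀) + n i • (m i₀ • p) ≤ 0 := by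
    intro i hi
    rw [hnew, sub_nonpos]
    by_cases hi' : 0 < m i
    · exact hratio i (Finset.mem_filter.2 ⟨hi, hi'⟩)
    · have e1 : m i₀ • H i ≤ 0 := smul_nonpos_of_nonneg_of_nonpos hm₀.le (h i hi)
      have e2 : 0 ≤ m i • H i₀ := smul_nonneg_of_nonpos_of_nonpos (not_lt.1 hi') (h i₀ hi₀S)
      exact e1.trans e2
  obtain ⟨r', p', h1, h2, h3, h4⟩ := ih _ hlt _ _ (zsmul_pos hp hm₀) hle rfl
  refine ⟨r', p', h1, h2, fun i hi hi0 => h3 i hi ?_, h4⟩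
  have e1 : H i = 0 := hi0
  have e2 : m i = 0 := hM0 i hi hi0
  rw [hnew, e1, e2, smul_zero, zero_smul, sub_zero]

/-- If the inequalities `∑ a i l • r l + n i • p ≤ 0` with `p > 0` have a solution in an ordered
group, then there is a rational linear form `L` with `n i ≤ L (a i)` for all `i`, with equality
wherever the solution has equality, and such that the vectors `a i` of the equalities span all
the `a i`. -/
theorem exists_rational_majorant (S : Finset ι) (a : ι → N → ℤ) (n : ι → ℤ) (r : N → Γ) (p : Γ)
    (hp : 0 < p) (h : ∀ i ∈ S, ∑ l, a i l • r l + n i • p ≤ 0) :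
    ∃ L : N → ℚ, (∀ i ∈ S, (n i : ℚ) ≤ ∑ l, L l * a i l) ∧
      (∀ i ∈ S, ∑ l, a i l • r l + n i • p = 0 → (n i : ℚ) = ∑ l, L l * a i l) ∧
      ∀ j ∈ S, (fun l => (a j l : ℚ)) ∈ Submodule.span ℚ
        ((fun i l => (a i l : ℚ)) '' {i | i ∈ S ∧ (n i : ℚ) = ∑ l, L l * a i l}) := by
  classical
  obtain ⟨r, p, hp, h, hold, hM⟩ := exists_tight_solution S a n r p hp h
  let T := S.filter fun i => ∑ l, a i l • r l + n i • p = 0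
  let A : ι → N → ℚ := fun i l => (a i l : ℚ)
  let f : (T → ℚ) →ₗ[ℚ] (N → ℚ) := Fintype.linearCombination ℚ fun i : T => A i
  let g : (T → ℚ) →ₗ[ℚ] ℚ := Fintype.linearCombination ℚ fun i : T => (n i : ℚ)
  have hT : ∀ i : T, ∑ l, a i l • r l = - (n i • p) := fun i =>
    eq_neg_of_add_eq_zero_left (Finset.mem_filter.1 i.2).2
  -- the numbers `n i` satisfy the linear relations of the vectors `a i`, for the equalities
  have hker : g ∈ (LinearMap.ker f).dualAnnihilator := by
    rw [Submodule.mem_dualAnnihilator]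
    intro β hβ
    obtain ⟨d, b, hd, hb⟩ := exists_common_denominator β
    have hb0 : ∀ l, ∑ i : T, b i * a i l = 0 := by
      intro l
      have h0 := congrFun (LinearMap.mem_ker.1 hβ) l
      simp only [f, Fintype.linearCombination_apply, Finset.sum_apply, Pi.smul_apply,
        smul_eq_mul, Pi.zero_apply, A] at h0
      have : ((∑ i : T, b i * a i l : ℤ) : ℚ) = 0 := by
        push_cast
        simp only [hb, mul_assoc, ← Finset.mul_sum, h0, mul_zero]
      exact_mod_cast this
    have hbn : (∑ i : T, b i * n i) • p = 0 := by
      have h1 : ∑ i : T, b i • (∑ l, a i l • r l) = 0 := by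
        simp only [Finset.smul_sum, smul_smul]
        rw [Finset.sum_comm]
        simp only [← Finset.sum_smul, hb0, zero_smul, Finset.sum_const_zero]
      simp only [hT, smul_neg, smul_smul, Finset.sum_neg_distrib, ← Finset.sum_smul] at h1
      exact neg_eq_zero.1 h1
    have hbn' : ∑ i : T, b i * n i = 0 := (smul_eq_zero.1 hbn).resolve_right hp.ne'
    have h2 : (d : ℚ) * g β = 0 := by
      simp only [g, Fintype.linearCombination_apply, smul_eq_mul, Finset.mul_sum, ← mul_assoc, ← hb]
      exact_mod_cast hbn'
    exact (mul_eq_zero.1 h2).resolve_left (by exact_mod_cast hd.ne')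
  rw [← LinearMap.range_dualMap_eq_dualAnnihilator_ker] at hker
  obtain ⟨φ, hφ⟩ := hker
  have hφ' : ∀ x : N → ℚ, φ x = ∑ l, φ (Pi.single l 1) * x l := by
    intro x
    rw [LinearMap.pi_apply_eq_sum_univ φ x]
    refine Finset.sum_congr rfl fun l _ => ?_
    rw [smul_eq_mul, mul_comm]
    congr 2
    ext j
    simp [Pi.single_apply, eq_comm]
  have hφT : ∀ i : T, φ (A i) = n i := by
    intro i
    have := LinearMap.congr_fun hφ (Pi.single i 1)
    simpa [f, g, Fintype.linearCombination_apply_single] using this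
  have hspan : ∀ j ∈ S, A j ∈ Submodule.span ℚ (A '' T) := by
    intro j hj
    by_contra hnot
    obtain ⟨ψ, hψj, hψ⟩ := Submodule.exists_le_ker_of_notMem hnot
    obtain ⟨d, M, hd, hMψ⟩ := exists_common_denominator fun l => ψ (Pi.single l 1)
    have key : ∀ i, ((∑ l, M l * a i l : ℤ) : ℚ) = d * ψ (A i) := by
      intro i
      rw [LinearMap.pi_apply_eq_sum_univ ψ (A i), Finset.mul_sum]
      push_cast
      refine Finset.sum_congr rfl fun l _ => ?_
      rw [hMψ, smul_eq_mul, mul_assoc, mul_comm _ (a i l : ℚ)]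
      congr 3
      ext j
      simp [Pi.single_apply, eq_comm]
    have := hM M (fun i hi hi0 => by
      have h1 : ψ (A i) = 0 := hψ (Submodule.subset_span
        ⟨i, Finset.mem_coe.2 (Finset.mem_filter.2 ⟨hi, hi0⟩), rfl⟩)
      have h2 := key i
      rw [h1, mul_zero] at h2
      exact_mod_cast h2) j hj
    have h3 := key j
    rw [this, Int.cast_zero] at h3
    exact hψj ((mul_eq_zero.1 h3.symm).resolve_left (by exact_mod_cast hd.ne'))
  refine ⟨fun l => φ (Pi.single l 1), fun j hj => ?_, fun i hi hi0 => ?_, fun j hj => ?_⟩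
  · rw [← hφ' (A j)]
    have hj' := hspan j hj
    have hrange : Submodule.span ℚ (A '' T) = LinearMap.range f := by
      rw [Fintype.range_linearCombination]
      congr 1
      ext x
      simp
    rw [hrange] at hj'
    obtain ⟨β, hβ⟩ := hj'
    obtain ⟨d, b, hd, hb⟩ := exists_common_denominator β
    have hda : ∀ l, d * a j l = ∑ i : T, b i * a i l := by
      intro l
      have h0 := congrFun hβ l
      simp only [f, Fintype.linearCombination_apply, Finset.sum_apply, Pi.smul_apply,
        smul_eq_mul, A] at h0
      have : ((d * a j l : ℤ) : ℚ) = ((∑ i : T, b i * a i l : ℤ) : ℚ) := by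
        push_cast
        rw [← h0, Finset.mul_sum]
        simp only [hb, mul_assoc]
      exact_mod_cast this
    have h1 : d • ∑ l, a j l • r l = - ((∑ i : T, b i * n i) • p) := by
      have h2 : ∑ i : T, b i • (∑ l, a i l • r l) = d • ∑ l, a j l • r l := by
        simp only [Finset.smul_sum, smul_smul, hda]
        rw [Finset.sum_comm]
        simp only [← Finset.sum_smul]
      rw [← h2]
      simp only [hT, smul_neg, smul_smul, Finset.sum_neg_distrib, ← Finset.sum_smul]
    have h3 : (d * n j - ∑ i : T, b i * n i) • p ≤ 0 := by
      have := smul_nonpos_of_nonneg_of_nonpos hd.le (h j hj)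
      rwa [smul_add, h1, smul_smul, neg_add_eq_sub, ← sub_smul] at this
    have h4 : d * n j - ∑ i : T, b i * n i ≤ 0 := by
      by_contra hpos
      exact absurd h3 (not_le.2 (zsmul_pos hp (not_le.1 hpos)))
    have h5 : (d : ℚ) * φ (A j) = ((∑ i : T, b i * n i : ℤ) : ℚ) := by
      rw [← hβ]
      simp only [f, Fintype.linearCombination_apply, map_sum, map_smul, hφT, smul_eq_mul,
        Finset.mul_sum, ← mul_assoc, ← hb]
      push_cast
      rfl
    have h6 : (d : ℚ) * n j ≤ d * φ (A j) := by
      rw [h5]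
      exact_mod_cast sub_nonpos.1 h4
    exact le_of_mul_le_mul_left h6 (by exact_mod_cast hd)
  · rw [← hφ' (A i)]
    exact (hφT ⟨i, Finset.mem_filter.2 ⟨hi, hold i hi hi0⟩⟩).symm
  · refine Submodule.span_mono (Set.image_mono fun i hi => ?_) (hspan j hj)
    refine ⟨(Finset.mem_filter.1 hi).1, ?_⟩
    rw [← hφ' (A i)]
    exact (hφT ⟨i, hi⟩).symm

end Majorant

namespace TorusSL2

/-! ### Admissible faces -/

section Faces

variable {k : ℕ}

theorem scal_add (u w R : (Fin k → ℚ) × ℚ) : scal (u + w) R = scal u R + scal w R := by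
  simp [scal, add_mul, Finset.sum_add_distrib]
  ring

theorem scal_smul (c : ℚ) (u R : (Fin k → ℚ) × ℚ) : scal (c • u) R = c * scal u R := by
  simp [scal, mul_add, Finset.mul_sum, mul_assoc]

theorem scal_sub (u w R : (Fin k → ℚ) × ℚ) : scal (u - w) R = scal u R - scal w R := by
  rw [sub_eq_add_neg, scal_add, ← neg_one_smul ℚ w, scal_smul]
  ring

/-- An admissible face is exactly the set of minima of a linear form `⟨·, R⟩` with `p < 0`. -/
theorem isAdmissible_iff {K F : Set ((Fin k → ℚ) × ℚ)} (hK : Convex ℚ K) :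
    IsAdmissible K F ↔ F.Nonempty ∧ ∃ (R : (Fin k → ℚ) × ℚ) (m : ℚ), R.2 < 0 ∧
      (∀ u ∈ K, m ≤ scal u R) ∧ F = {u | u ∈ K ∧ scal u R = m} := by
  have hface : ∀ (R : (Fin k → ℚ) × ℚ) (m : ℚ), (∀ u ∈ K, m ≤ scal u R) →
      {u | u ∈ K ∧ scal u R = m}.Nonempty → IsFace K {u | u ∈ K ∧ scal u R = m} := by
    intro R m hm hne
    refine ⟨hne, ?_, ?_⟩
    · rintro u ⟨hu, hum⟩ w ⟨hw, hwm⟩ a b ha hb hab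
      refine ⟨hK hu hw ha hb hab, ?_⟩
      rw [scal_add, scal_smul, scal_smul, hum, hwm, ← add_mul, hab, one_mul]
    · refine ⟨fun u hu => hu.1, ?_⟩
      rintro u hu w hw x ⟨hx, hxm⟩ ⟨a, b, ha, hb, hab, rfl⟩
      refine ⟨hu, le_antisymm ?_ (hm u hu)⟩
      rw [scal_add, scal_smul, scal_smul] at hxm
      have h1 := hm w hw
      have h2 : a * scal u R ≤ a * m := by
        have : b * m ≤ b * scal w R := mul_le_mul_of_nonneg_left h1 hb.le
        have h3 : m = a * m + b * m := by rw [← add_mul, hab, one_mul]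
        linarith
      exact le_of_mul_le_mul_left h2 ha
  constructor
  · rintro ⟨hF, R, hR, horth, hmax, hdir⟩
    obtain ⟨u₀, hu₀⟩ := hF.1
    refine ⟨hF.1, R, scal u₀ R, hR, fun u hu => ?_, ?_⟩
    · have := hdir u₀ hu₀ u hu
      rw [scal_sub] at this
      linarith
    · by_contra hne
      have hsub : F ⊆ {u | u ∈ K ∧ scal u R = scal u₀ R} := fun u hu => by
        refine ⟨hF.2.2.1 hu, ?_⟩
        have := horth u hu u₀ hu₀
        rw [scal_sub] at this
        linarith
      refine hmax _ (hface R _ (fun u hu => ?_) ⟨u₀, hsub hu₀⟩) (hsub.ssubset_of_ne hne) ?_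
      · have := hdir u₀ hu₀ u hu
        rw [scal_sub] at this
        linarith
      · rintro u ⟨_, hu⟩ w ⟨_, hw⟩
        rw [scal_sub, hu, hw, sub_self]
  · rintro ⟨hne, R, m, hR, hm, rfl⟩
    refine ⟨hface R m hm hne, R, hR, ?_, ?_, ?_⟩
    · rintro u ⟨_, hu⟩ w ⟨_, hw⟩
      rw [scal_sub, hu, hw, sub_self]
    · intro F' hF' hlt horth
      obtain ⟨u, hu⟩ := hne
      refine hlt.2 fun w hw => ⟨hF'.2.2.1 hw, ?_⟩
      have := horth w hw u (hlt.1 hu)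
      rw [scal_sub] at this
      linarith [hu.2]
    · rintro u ⟨_, hu⟩ w hw
      rw [scal_sub, hu]
      linarith [hm w hw]

/-- The projection to `ℚ^k` is injective on the directions of an admissible face. -/
theorem faceDim_le_of_isAdmissible {A F : Set ((Fin k → ℚ) × ℚ)}
    (hF : IsAdmissible (convexHull ℚ A) F) :
    faceDim F ≤ Module.finrank ℚ (vectorSpan ℚ (Prod.fst '' A)) := by
  obtain ⟨-, R, m, hR, hm, rfl⟩ := (isAdmissible_iff (convex_convexHull ℚ A)).1 hF
  set F := {u | u ∈ convexHull ℚ A ∧ scal u R = m} with hFdef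
  let π : (Fin k → ℚ) × ℚ →ₗ[ℚ] Fin k → ℚ := LinearMap.fst ℚ _ _
  have h0 : ∀ u ∈ vectorSpan ℚ F, scal u R = 0 := by
    intro u hu
    rw [vectorSpan_def] at hu
    induction hu using Submodule.span_induction with
    | mem x hx =>
      obtain ⟨a, ha, b, hb, rfl⟩ := hx
      change scal (a - b) R = 0
      rw [scal_sub, ha.2, hb.2, sub_self]
    | zero => simp [scal]
    | add x y _ _ hx hy => rw [scal_add, hx, hy, add_zero]
    | smul c x _ hx => rw [scal_smul, hx, mul_zero]
  have hinj : Function.Injective (π.domRestrict (vectorSpan ℚ F)) := by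
    rw [← LinearMap.ker_eq_bot, LinearMap.ker_eq_bot']
    rintro ⟨u, hu⟩ hu0
    have h1 : u.1 = 0 := hu0
    have h2 := h0 u hu
    simp only [scal, h1, Pi.zero_apply, zero_mul, Finset.sum_const_zero, zero_add] at h2
    exact Subtype.ext (Prod.ext h1 ((mul_eq_zero.1 h2).resolve_right hR.ne))
  have hrange : LinearMap.range (π.domRestrict (vectorSpan ℚ F)) ≤
      vectorSpan ℚ (Prod.fst '' A) := by
    rw [LinearMap.range_domRestrict]
    have e1 : (vectorSpan ℚ F).map π = vectorSpan ℚ (π '' F) := by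
      have := AffineMap.map_vectorSpan (s := F) π.toAffineMap
      rwa [LinearMap.toAffineMap_linear] at this
    have e2 : π '' convexHull ℚ A = convexHull ℚ (π '' A) := LinearMap.image_convexHull π A
    have e3 : vectorSpan ℚ (convexHull ℚ (π '' A)) = vectorSpan ℚ (π '' A) := by
      rw [← direction_affineSpan, affineSpan_convexHull, direction_affineSpan]
    rw [e1]
    refine (vectorSpan_mono ℚ (Set.image_mono fun u hu => hu.1)).trans ?_
    rw [e2, e3]
    rfl
  rw [faceDim, ← LinearMap.finrank_range_of_inj hinj]
  exact Submodule.finrank_mono hrange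

variable {s : ℕ} {χ : Fin s → Fin k → ℤ} {n : Fin s → ℕ}

/-- The coordinates `(1, χ i)`; linear relations among them are the affine relations among the
characters. -/
def augChar (χ : Fin s → Fin k → ℤ) (i : Fin s) : Option (Fin k) → ℤ := fun l => l.elim 1 (χ i)

/-- An affine function `L` on `ℚ^k` whose graph lies above all characteristic points cuts out an
admissible face. If the characters below the graph's contact points span affinely all the
characters, then this face has maximal dimension. -/
theorem exists_isMaxAdmissible (v : Mod χ n) (hv : v ≠ 0) (L : Option (Fin k) → ℚ)
    (hL : ∀ i, comp v i ≠ 0 → (n i : ℚ) ≤ ∑ l, L l * augChar χ i l)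
    (hspan : ∀ j, comp v j ≠ 0 → (fun l => (augChar χ j l : ℚ)) ∈ Submodule.span ℚ
        ((fun i l => (augChar χ i l : ℚ)) ''
          {i | comp v i ≠ 0 ∧ (n i : ℚ) = ∑ l, L l * augChar χ i l})) :
    ∃ F, IsMaxAdmissible (polyhedron v) F ∧
      ∀ i, comp v i ≠ 0 → (n i : ℚ) = ∑ l, L l * augChar χ i l → charPoint χ n i ∈ F := by
  let R : (Fin k → ℚ) × ℚ := (fun j => L (some j), -1)
  let A : Set ((Fin k → ℚ) × ℚ) := {u | ∃ i, comp v i ≠ 0 ∧ u = charPoint χ n i}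
  let T : Set (Fin s) := {i | comp v i ≠ 0 ∧ (n i : ℚ) = ∑ l, L l * augChar χ i l}
  have hscal : ∀ i, scal (charPoint χ n i) R = ∑ l, L l * augChar χ i l - n i - L none := by
    intro i
    simp only [scal, charPoint, R, augChar, Fintype.sum_option, Option.elim]
    have : ∑ j, (χ i j : ℚ) * L (some j) = ∑ j, L (some j) * (χ i j : ℚ) :=
      Finset.sum_congr rfl fun j _ => mul_comm _ _
    rw [this]
    push_cast
    ring
  have hA : ∀ i, comp v i ≠ 0 → charPoint χ n i ∈ convexHull ℚ A := fun i hi =>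
    subset_convexHull ℚ A ⟨i, hi, rfl⟩
  have hm : ∀ u ∈ convexHull ℚ A, -L none ≤ scal u R := by
    have hconv : Convex ℚ {u : (Fin k → ℚ) × ℚ | -L none ≤ scal u R} := by
      intro u hu w hw a b ha hb hab
      simp only [Set.mem_ofPred_eq] at hu hw ⊢
      rw [scal_add, scal_smul, scal_smul]
      have h1 := mul_le_mul_of_nonneg_left hu ha
      have h2 := mul_le_mul_of_nonneg_left hw hb
      have h3 : -L none = a * -L none + b * -L none := by rw [← add_mul, hab, one_mul]
      linarith
    refine fun u hu => convexHull_min ?_ hconv hu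
    rintro _ ⟨i, hi, rfl⟩
    simp only [Set.mem_ofPred_eq]
    rw [hscal]
    linarith [hL i hi]
  have hmem : ∀ i ∈ T, charPoint χ n i ∈ {u | u ∈ convexHull ℚ A ∧ scal u R = -L none} := by
    rintro i ⟨hi, hi'⟩
    refine ⟨hA i hi, ?_⟩
    rw [hscal, ← hi']
    ring
  obtain ⟨i₁, hi₁⟩ : ∃ i, comp v i ≠ 0 := by
    by_contra! h
    exact hv (ext_comp h)
  obtain ⟨i₀, hi₀⟩ : T.Nonempty := by
    rw [Set.nonempty_iff_ne_empty]
    intro hT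
    have h1 := hspan i₁ hi₁
    rw [show {i | comp v i ≠ 0 ∧ (n i : ℚ) = ∑ l, L l * augChar χ i l} = ∅ from hT,
      Set.image_empty, Submodule.span_empty, Submodule.mem_bot] at h1
    have := congrFun h1 none
    simp [augChar] at this
  have hadm : IsAdmissible (polyhedron v) {u | u ∈ convexHull ℚ A ∧ scal u R = -L none} :=
    (isAdmissible_iff (convex_convexHull ℚ A)).2
      ⟨⟨_, hmem i₀ hi₀⟩, R, -L none, by norm_num [R], hm, rfl⟩
  refine ⟨_, ⟨hadm, fun F' hF' => (faceDim_le_of_isAdmissible hF').trans ?_⟩,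
    fun i hi hi' => hmem i ⟨hi, hi'⟩⟩
  set F := {u | u ∈ convexHull ℚ A ∧ scal u R = -L none}
  let π : (Fin k → ℚ) × ℚ →ₗ[ℚ] Fin k → ℚ := LinearMap.fst ℚ _ _
  let χ' : Fin s → Fin k → ℚ := fun i j => (χ i j : ℚ)
  have hW : ∀ j, comp v j ≠ 0 → χ' j - χ' i₀ ∈ (vectorSpan ℚ F).map π := by
    intro j hj
    let q : (Option (Fin k) → ℚ) →ₗ[ℚ] (Fin k → ℚ) :=
      LinearMap.funLeft ℚ ℚ some - (LinearMap.proj none).smulRight (χ' i₀)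
    have hq : ∀ i, q (fun l => (augChar χ i l : ℚ)) = χ' i - χ' i₀ := fun i => by
      ext l
      simp [q, augChar, χ', LinearMap.funLeft_apply]
    have hle : Submodule.span ℚ ((fun i l => (augChar χ i l : ℚ)) '' T) ≤
        ((vectorSpan ℚ F).map π).comap q := by
      rw [Submodule.span_le]
      rintro _ ⟨i, hi, rfl⟩
      rw [SetLike.mem_coe, Submodule.mem_comap, hq]
      exact ⟨charPoint χ n i - charPoint χ n i₀,
        vsub_mem_vectorSpan ℚ (hmem i hi) (hmem i₀ hi₀), rfl⟩
    have := hle (hspan j hj)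
    rwa [Submodule.mem_comap, hq] at this
  have hle : vectorSpan ℚ (Prod.fst '' A) ≤ (vectorSpan ℚ F).map π := by
    rw [vectorSpan_def, Submodule.span_le]
    rintro _ ⟨_, ⟨_, ⟨i, hi, rfl⟩, rfl⟩, _, ⟨_, ⟨j, hj, rfl⟩, rfl⟩, rfl⟩
    have := Submodule.sub_mem _ (hW i hi) (hW j hj)
    rwa [sub_sub_sub_cancel_right] at this
  exact (Submodule.finrank_mono hle).trans (Submodule.finrank_map_le π _)

/-- A vector of weights in an ordered group that is maximal exactly at the indices in `J` puts the
points with indices in `J` on a common admissible face of maximal dimension. -/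
theorem exists_isMaxAdmissible_of_le {Γ : Type*} [AddCommGroup Γ] [LinearOrder Γ]
    [IsOrderedAddMonoid Γ] (v : Mod χ n) (hv : v ≠ 0) (r : Option (Fin k) → Γ) (p : Γ)
    (hp : 0 < p) (h : ∀ i, comp v i ≠ 0 → ∑ l, augChar χ i l • r l + (n i : ℤ) • p ≤ 0) :
    ∃ F, IsMaxAdmissible (polyhedron v) F ∧ ∀ i, comp v i ≠ 0 →
      ∑ l, augChar χ i l • r l + (n i : ℤ) • p = 0 → charPoint χ n i ∈ F := by
  classical
  obtain ⟨L, hL, hL', hspan⟩ := exists_rational_majorant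
    (Finset.univ.filter fun i => comp v i ≠ 0) (augChar χ) (fun i => (n i : ℤ)) r p hp
    (fun i hi => h i (Finset.mem_filter.1 hi).2)
  simp only [Finset.mem_filter, Finset.mem_univ, true_and, Int.cast_natCast] at hL hL' hspan
  obtain ⟨F, hF, hFmem⟩ := exists_isMaxAdmissible v hv L hL hspan
  exact ⟨F, hF, fun i hi hi' => hFmem i hi (hL' i hi hi')⟩

end Faces

end TorusSL2

/-! ### Products of powers of univariate polynomials -/

section PowerProducts

variable {ι : Type*}

theorem rootMultiplicity_prod_pow (J : Finset ι) (f : ι → Polynomial ℂ)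
    (hf : ∀ i ∈ J, f i ≠ 0) (m : ι → ℕ) (r : ℂ) :
    (∏ i ∈ J, f i ^ m i).rootMultiplicity r = ∑ i ∈ J, m i * (f i).rootMultiplicity r := by
  classical
  have h0 : ∏ i ∈ J, f i ^ m i ≠ 0 := Finset.prod_ne_zero_iff.2 fun i hi => pow_ne_zero _ (hf i hi)
  induction J using Finset.cons_induction with
  | empty => simp
  | cons i J hi ih =>
    rw [Finset.prod_cons] at h0 ⊢
    rw [Polynomial.rootMultiplicity_mul h0, Finset.sum_cons,
      ih (fun j hj => hf j (Finset.mem_cons_of_mem hj)) (right_ne_zero_of_mul h0),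
      ← Polynomial.count_roots, Polynomial.roots_pow, Multiset.count_nsmul, Polynomial.count_roots]

theorem prod_zpow_eval (J : Finset ι) (f : ι → Polynomial ℂ) (β : ι → ℤ) (z : ℂ)
    (hz : ∀ i ∈ J, (f i).eval z ≠ 0) :
    (∏ i ∈ J, (f i).eval z ^ β i) * (∏ i ∈ J, f i ^ (-β i).toNat).eval z =
      (∏ i ∈ J, f i ^ (β i).toNat).eval z := by
  rw [Polynomial.eval_prod, Polynomial.eval_prod, ← Finset.prod_mul_distrib]
  refine Finset.prod_congr rfl fun i hi => ?_
  rw [Polynomial.eval_pow, Polynomial.eval_pow, ← zpow_natCast, ← zpow_natCast,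
    ← zpow_add₀ (hz i hi)]
  congr 1
  omega

theorem sum_toNat_eq_iff (J : Finset ι) (β : ι → ℤ) (e : ι → ℕ) :
    ∑ i ∈ J, (β i).toNat * e i = ∑ i ∈ J, (-β i).toNat * e i ↔ ∑ i ∈ J, (e i : ℤ) * β i = 0 := by
  have : ∑ i ∈ J, (e i : ℤ) * β i =
      ((∑ i ∈ J, (β i).toNat * e i : ℕ) : ℤ) - ((∑ i ∈ J, (-β i).toNat * e i : ℕ) : ℤ) := by
    push_cast
    rw [← Finset.sum_sub_distrib]
    refine Finset.sum_congr rfl fun i _ => ?_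
    rw [← sub_mul, mul_comm]
    congr 1
    omega
  rw [this, sub_eq_zero]
  exact_mod_cast Iff.rfl

/-- A product of powers of polynomials without zeros and poles is constant. -/
theorem prod_zpow_eval_eq_of_sum_eq_zero (J : Finset ι) (f : ι → Polynomial ℂ)
    (hf : ∀ i ∈ J, f i ≠ 0) (β : ι → ℤ)
    (h : ∀ r, ∑ i ∈ J, ((f i).rootMultiplicity r : ℤ) * β i = 0) {z w : ℂ}
    (hz : ∀ i ∈ J, (f i).eval z ≠ 0) (hw : ∀ i ∈ J, (f i).eval w ≠ 0) :
    ∏ i ∈ J, (f i).eval z ^ β i = ∏ i ∈ J, (f i).eval w ^ β i := by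
  classical
  set A := ∏ i ∈ J, f i ^ (β i).toNat with hA
  set B := ∏ i ∈ J, f i ^ (-β i).toNat with hB
  have hB0 : B ≠ 0 := Finset.prod_ne_zero_iff.2 fun i hi => pow_ne_zero _ (hf i hi)
  have hroots : A.roots = B.roots := by
    ext r
    rw [Polynomial.count_roots, Polynomial.count_roots, rootMultiplicity_prod_pow J f hf,
      rootMultiplicity_prod_pow J f hf]
    exact (sum_toNat_eq_iff J β _).2 (h r)
  have hAB : Polynomial.C B.leadingCoeff * A = Polynomial.C A.leadingCoeff * B := by
    have h1 := (IsAlgClosed.splits A).eq_prod_roots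
    have h2 := (IsAlgClosed.splits B).eq_prod_roots
    rw [hroots] at h1
    exact (congrArg _ h1).trans ((mul_left_comm _ _ _).trans (congrArg _ h2.symm))
  have key : ∀ y, (∀ i ∈ J, (f i).eval y ≠ 0) →
      B.leadingCoeff * ∏ i ∈ J, (f i).eval y ^ β i = A.leadingCoeff := by
    intro y hy
    have hBy : B.eval y ≠ 0 := by
      rw [hB, Polynomial.eval_prod, Finset.prod_ne_zero_iff]
      intro i hi
      rw [Polynomial.eval_pow]
      exact pow_ne_zero _ (hy i hi)
    have h1 := prod_zpow_eval J f β y hy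
    have h2 := congrArg (Polynomial.eval y) hAB
    rw [Polynomial.eval_mul, Polynomial.eval_C, Polynomial.eval_mul, Polynomial.eval_C] at h2
    rw [← hA, ← hB] at h1
    rw [← h1, ← mul_assoc] at h2
    exact mul_right_cancel₀ hBy h2
  exact mul_left_cancel₀ (Polynomial.leadingCoeff_ne_zero.2 hB0) ((key z hz).trans (key w hw).symm)

/-- A product of powers of polynomials that takes one value infinitely often has no zeros or
poles. -/
theorem sum_eq_zero_of_prod_zpow_eval_eq (J : Finset ι) (f : ι → Polynomial ℂ)
    (hf : ∀ i ∈ J, f i ≠ 0) (β : ι → ℤ) (c : ℂ) {Λ : Set ℂ} (hΛ : Λ.Infinite)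
    (h0 : ∀ z ∈ Λ, ∀ i ∈ J, (f i).eval z ≠ 0)
    (h : ∀ z ∈ Λ, ∏ i ∈ J, (f i).eval z ^ β i = c) (r : ℂ) :
    ∑ i ∈ J, ((f i).rootMultiplicity r : ℤ) * β i = 0 := by
  have hc : c ≠ 0 := by
    obtain ⟨z, hz⟩ := hΛ.nonempty
    rw [← h z hz, Finset.prod_ne_zero_iff]
    exact fun i hi => zpow_ne_zero _ (h0 z hz i hi)
  have hAB : Polynomial.C c * ∏ i ∈ J, f i ^ (-β i).toNat = ∏ i ∈ J, f i ^ (β i).toNat := by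
    refine Polynomial.eq_of_infinite_eval_eq _ _ (hΛ.mono fun z hz => ?_)
    rw [Set.mem_ofPred_eq, Polynomial.eval_mul, Polynomial.eval_C, ← h z hz,
      prod_zpow_eval J f β z (h0 z hz)]
  rw [← sum_toNat_eq_iff, ← rootMultiplicity_prod_pow J f hf, ← rootMultiplicity_prod_pow J f hf,
    ← hAB, Polynomial.rootMultiplicity_mul, Polynomial.rootMultiplicity_C, zero_add]
  exact mul_ne_zero (Polynomial.C_ne_zero.2 hc)
    (Finset.prod_ne_zero_iff.2 fun i hi => pow_ne_zero _ (hf i hi))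

end PowerProducts

/-! ### Binary forms -/

theorem degree_eq_of_isHomogeneous {σ R : Type*} [CommSemiring R] {F : MvPolynomial σ R} {m : ℕ}
    (hF : F.IsHomogeneous m) {d : σ →₀ ℕ} (hd : coeff d F ≠ 0) : d.degree = m := by
  rw [Finsupp.degree_eq_weight_one]
  exact hF hd

theorem aeval_mul_of_isHomogeneous {σ R A : Type*} [CommRing R] [CommRing A] [Algebra R A]
    {F : MvPolynomial σ R} {m : ℕ} (hF : F.IsHomogeneous m) (z : A) (g : σ → A) :
    aeval (fun b => z * g b) F = z ^ m * aeval g F := by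
  rw [aeval_def, aeval_def, eval₂_eq, eval₂_eq, Finset.mul_sum]
  refine Finset.sum_congr rfl fun d hd => ?_
  have hdeg : ∑ i ∈ d.support, d i = m := by
    have := degree_eq_of_isHomogeneous hF (mem_support_iff.1 hd)
    rwa [Finsupp.degree_apply] at this
  simp only [mul_pow, Finset.prod_mul_distrib, Finset.prod_pow_eq_pow_sum, hdeg]
  ring

namespace TorusSL2

section Forms

variable {R : Type*} [CommRing R]

/-- The substitution `subst` over an arbitrary commutative ring. -/
noncomputable def substR (g : Matrix (Fin 2) (Fin 2) R) :
    MvPolynomial (Fin 2) R →ₐ[R] MvPolynomial (Fin 2) R :=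
  aeval fun b => C (g 0 b) * X 0 + C (g 1 b) * X 1

theorem substR_eq_subst (g : Matrix (Fin 2) (Fin 2) ℂ) : substR g = subst g := rfl

theorem substR_X (g : Matrix (Fin 2) (Fin 2) R) (b : Fin 2) :
    substR g (X b) = C (g 0 b) * X 0 + C (g 1 b) * X 1 := by
  simp [substR]

theorem substR_one : substR (1 : Matrix (Fin 2) (Fin 2) R) = AlgHom.id R _ := by
  ext b
  fin_cases b <;> simp [substR]

theorem substR_mul (g h : Matrix (Fin 2) (Fin 2) R) :
    substR (g * h) = (substR g).comp (substR h) := by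
  ext1 b
  simp only [substR, aeval_X, AlgHom.comp_apply, map_add, map_mul, Matrix.mul_apply,
    Fin.sum_univ_two, algHom_C, algebraMap_eq]
  ring

theorem substR_mul_apply (g h : Matrix (Fin 2) (Fin 2) R) (F : MvPolynomial (Fin 2) R) :
    substR (g * h) F = substR g (substR h F) := by
  rw [substR_mul, AlgHom.comp_apply]

theorem map_substR {S : Type*} [CommRing S] (φ : R →+* S) (g : Matrix (Fin 2) (Fin 2) R)
    (F : MvPolynomial (Fin 2) R) :
    MvPolynomial.map φ (substR g F) = substR (φ.mapMatrix g) (MvPolynomial.map φ F) := by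
  induction F using MvPolynomial.induction_on with
  | C a => simp [substR]
  | add p q hp hq => simp only [map_add, hp, hq]
  | mul_X p b hp => simp only [map_mul, hp, map_X, substR_X]; simp

theorem substR_smul (c : R) (g : Matrix (Fin 2) (Fin 2) R) {F : MvPolynomial (Fin 2) R} {m : ℕ}
    (hF : F.IsHomogeneous m) : substR (c • g) F = C (c ^ m) * substR g F := by
  have : substR (c • g) = aeval fun b => C c * (C (g 0 b) * X 0 + C (g 1 b) * X 1) := by
    ext1 b
    simp [substR]
    ring
  rw [this, aeval_mul_of_isHomogeneous hF, map_pow]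
  rfl

theorem substR_row (g : Fin 2 → R) {F : MvPolynomial (Fin 2) R} {m : ℕ} (hF : F.IsHomogeneous m) :
    substR (Matrix.of ![g, 0]) F = C (eval g F) * X 0 ^ m := by
  have : substR (Matrix.of ![g, 0]) = aeval fun b => X 0 * C (g b) := by
    ext1 b
    simp [substR, mul_comm]
  rw [this, aeval_mul_of_isHomogeneous hF, mul_comm]
  congr 1
  rw [← MvPolynomial.coe_aeval_eq_eval, RingHom.coe_coe, ← algebraMap_eq]
  exact (MvPolynomial.aeval_algebraMap_apply _ g F)

theorem eval_row_substR (g : Matrix (Fin 2) (Fin 2) R) (F : MvPolynomial (Fin 2) R) :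
    eval ![1, 0] (substR g F) = eval (g 0) F := by
  rw [substR, ← MvPolynomial.coe_aeval_eq_eval, ← MvPolynomial.coe_aeval_eq_eval, RingHom.coe_coe,
    RingHom.coe_coe, ← AlgHom.comp_apply, MvPolynomial.comp_aeval]
  congr 2
  ext b
  simp

/-- A form that vanishes on the line `y = 0` is divisible by `y`. -/
theorem X_one_dvd_of_substR_eq_zero {F : MvPolynomial (Fin 2) R}
    (h : substR !![1, 0; 0, 0] F = 0) : X 1 ∣ F := by
  have key : X 1 ∣ F - substR !![1, 0; 0, 0] F := by
    clear h
    induction F using MvPolynomial.induction_on with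
    | C a => simp [substR]
    | add p q hp hq =>
      rw [map_add, add_sub_add_comm]
      exact dvd_add hp hq
    | mul_X p b hp =>
      have hb : (X 1 : MvPolynomial (Fin 2) R) ∣ X b - substR !![1, 0; 0, 0] (X b) := by
        fin_cases b <;> simp [substR]
      rw [map_mul, show p * X b - substR !![1, 0; 0, 0] p * substR !![1, 0; 0, 0] (X b) =
        (p - substR !![1, 0; 0, 0] p) * X b +
          substR !![1, 0; 0, 0] p * (X b - substR !![1, 0; 0, 0] (X b)) by ring]
      exact dvd_add (hp.mul_right _) (hb.mul_left _)
  rwa [h, sub_zero] at key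

/-- A nonzero form is `y ^ e * u`, where `u` does not vanish on the line `y = 0`. -/
theorem exists_eq_X_one_pow_mul {F : MvPolynomial (Fin 2) ℂ} {m : ℕ} (hF : F.IsHomogeneous m)
    (h0 : F ≠ 0) : ∃ (e : ℕ) (u : MvPolynomial (Fin 2) ℂ), e ≤ m ∧ F = X 1 ^ e * u ∧
      u.IsHomogeneous (m - e) ∧ subst !![1, 0; 0, 0] u ≠ 0 := by
  have hfin : FiniteMultiplicity (X 1 : MvPolynomial (Fin 2) ℂ) F :=
    FiniteMultiplicity.of_not_isUnit X_prime.not_isUnit h0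
  obtain ⟨u, hu, hnot⟩ := hfin.exists_eq_pow_mul_and_not_dvd
  set e := multiplicity (X 1 : MvPolynomial (Fin 2) ℂ) F
  have hdeg : ∀ d, coeff d u ≠ 0 → e + Finsupp.weight 1 d = m := by
    intro d hd
    have h1 : coeff (Finsupp.single 1 e + d) F = coeff d u := by
      rw [hu, X_pow_eq_monomial, coeff_monomial_mul, one_mul]
    have h2 := hF (d := Finsupp.single 1 e + d) (by rwa [h1])
    rw [map_add, Finsupp.weight_single] at h2
    simpa using h2
  have hu0 : u ≠ 0 := by
    rintro rfl
    exact h0 (by rw [hu, mul_zero])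
  obtain ⟨d, hd⟩ := MvPolynomial.ne_zero_iff.1 hu0
  refine ⟨e, u, ?_, hu, fun d hd => ?_, fun h => hnot (X_one_dvd_of_substR_eq_zero h)⟩
  · have := hdeg d hd
    omega
  · have := hdeg d hd
    omega

/-- The univariate polynomial `F(1, X)`. -/
noncomputable def dehom (F : MvPolynomial (Fin 2) ℂ) : Polynomial ℂ :=
  aeval ![1, Polynomial.X] F

theorem eval_dehom (F : MvPolynomial (Fin 2) ℂ) (z : ℂ) :
    (dehom F).eval z = eval ![1, z] F := by
  rw [dehom, ← Polynomial.coe_aeval_eq_eval, ← AlgHom.comp_apply, MvPolynomial.comp_aeval,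
    ← MvPolynomial.coe_aeval_eq_eval, RingHom.coe_coe]
  congr 2
  ext b
  fin_cases b <;> simp

theorem homogenize_dehom {F : MvPolynomial (Fin 2) ℂ} {m : ℕ} (hF : F.IsHomogeneous m) :
    (dehom F).homogenize m = rename (Equiv.swap 0 1) F := by
  refine Polynomial.homogenize_eq_of_isHomogeneous
    ((IsHomogeneous.rename_isHomogeneous_iff (Equiv.injective _)).2 hF) ?_
  rw [aeval_rename, dehom]
  congr 2
  ext b
  fin_cases b <;> simp

theorem dehom_ne_zero {F : MvPolynomial (Fin 2) ℂ} {m : ℕ} (hF : F.IsHomogeneous m)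
    (h0 : F ≠ 0) : dehom F ≠ 0 := by
  intro h
  have := homogenize_dehom hF
  rw [h, Polynomial.homogenize_zero] at this
  exact h0 ((rename_injective _ (Equiv.injective _)) (by rw [← this, map_zero]))

theorem natDegree_dehom_le {F : MvPolynomial (Fin 2) ℂ} {m : ℕ} (hF : F.IsHomogeneous m) :
    (dehom F).natDegree ≤ m := by
  rw [dehom, F.as_sum, map_sum]
  refine Polynomial.natDegree_sum_le_of_forall_le _ _ fun d hd => ?_
  have hdeg := degree_eq_of_isHomogeneous hF (mem_support_iff.1 hd)
  rw [Finsupp.degree_eq_sum, Fin.sum_univ_two] at hdeg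
  rw [aeval_monomial, Finsupp.prod_fintype _ _ (fun _ => pow_zero _), Fin.prod_univ_two]
  simp only [Matrix.cons_val_zero, one_pow, one_mul, Matrix.cons_val_one,
    ← Polynomial.C_eq_algebraMap]
  exact (Polynomial.natDegree_C_mul_X_pow_le _ _).trans (by omega)

theorem pow_dvd_iff_pow_dvd_dehom {F : MvPolynomial (Fin 2) ℂ} {m : ℕ} (hF : F.IsHomogeneous m)
    (h0 : F ≠ 0) (a : ℂ) (j : ℕ) :
    (C a * X 0 + X 1) ^ j ∣ F ↔ (Polynomial.X - Polynomial.C (-a)) ^ j ∣ dehom F := by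
  constructor
  · rintro ⟨G, rfl⟩
    refine ⟨dehom G, ?_⟩
    simp [dehom, add_comm, Polynomial.algebraMap_eq]
  · rintro ⟨h, hh⟩
    have hd : dehom F ≠ 0 := dehom_ne_zero hF h0
    have hh0 : h ≠ 0 := by
      rintro rfl
      exact hd (by rw [hh, mul_zero])
    have hdeg : j + h.natDegree ≤ m := by
      have := natDegree_dehom_le hF
      rwa [hh, Polynomial.natDegree_mul (pow_ne_zero _ (Polynomial.X_sub_C_ne_zero _)) hh0,
        Polynomial.natDegree_pow, Polynomial.natDegree_X_sub_C, mul_one] at this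
    have h1 := homogenize_dehom hF
    obtain ⟨d, rfl⟩ := Nat.exists_eq_add_of_le hdeg
    rw [hh, add_assoc, Polynomial.homogenize_mul _ _ (by simp) (Nat.le_add_right _ _)] at h1
    have h2 : ((Polynomial.X - Polynomial.C (-a)) ^ j).homogenize j =
        (X 0 + C a * X 1 : MvPolynomial (Fin 2) ℂ) ^ j := by
      refine Polynomial.homogenize_eq_of_isHomogeneous ?_ ?_
      · have := ((isHomogeneous_X ℂ (0 : Fin 2)).add (isHomogeneous_C_mul_X a (1 : Fin 2))).pow j
        rwa [one_mul] at this
      · simp [Polynomial.algebraMap_eq]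
    have h3 := congrArg (rename (Equiv.swap (0 : Fin 2) 1)) h1
    rw [h2, rename_rename] at h3
    have h4 : ((Equiv.swap (0 : Fin 2) 1) ∘ (Equiv.swap (0 : Fin 2) 1) : Fin 2 → Fin 2) = id := by
      ext b
      simp
    rw [h4, rename_id_apply] at h3
    rw [← h3, map_mul, map_pow, map_add, map_mul, rename_X, rename_X, rename_C]
    simp [add_comm]

end Forms

variable {k s : ℕ} {χ : Fin s → Fin k → ℤ} {n : Fin s → ℕ}

theorem comp_isHomogeneous (v : Mod χ n) (i : Fin s) : (comp v i).IsHomogeneous (n i) := (v i).2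

theorem mult_eq_rootMultiplicity (v : Mod χ n) {i : Fin s} (hi : comp v i ≠ 0) (a : ℂ) :
    mult v i a = (dehom (comp v i)).rootMultiplicity (-a) := by
  have hd := dehom_ne_zero (comp_isHomogeneous v i) hi
  refine multiplicity_eq_of_dvd_of_not_dvd ?_ ?_
  · rw [pow_dvd_iff_pow_dvd_dehom (comp_isHomogeneous v i) hi,
      ← Polynomial.le_rootMultiplicity_iff hd]
  · rw [pow_dvd_iff_pow_dvd_dehom (comp_isHomogeneous v i) hi,
      ← Polynomial.le_rootMultiplicity_iff hd]
    omega

end TorusSL2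

/-! ### Multiplicative relations of monomials -/

theorem prod_zpow_const {G ι : Type*} [CommGroup G] (J : Finset ι) (x : G) (f : ι → ℤ) :
    ∏ i ∈ J, x ^ f i = x ^ ∑ i ∈ J, f i := by
  induction J using Finset.cons_induction with
  | empty => simp
  | cons i J hi ih => rw [Finset.prod_cons, Finset.sum_cons, zpow_add, ih]

theorem prod_monomial_zpow_eq_one {G ι N : Type*} [CommGroup G] [Fintype N] (J : Finset ι)
    (τ : N → G) (m : ι → N → ℤ) (β : ι → ℤ) (h : ∀ l, ∑ i ∈ J, β i * m i l = 0) :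
    ∏ i ∈ J, (∏ l, τ l ^ m i l) ^ β i = 1 := by
  simp only [← Finset.prod_zpow, ← zpow_mul]
  rw [Finset.prod_comm]
  refine Finset.prod_eq_one fun l _ => ?_
  rw [prod_zpow_const, Finset.sum_congr rfl fun i _ => mul_comm (m i l) (β i), h, zpow_zero]

namespace TorusSL2

variable {k s : ℕ} {χ : Fin s → Fin k → ℤ} {n : Fin s → ℕ}

/-! ### Points of the closure of an orbit -/

/-- The vector of `V` with given components. -/
def ofComp (f : Fin s → MvPolynomial (Fin 2) ℂ) (hf : ∀ i, (f i).IsHomogeneous (n i)) : Mod χ n :=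
  fun i => ⟨f i, hf i⟩

theorem comp_ofComp (f : Fin s → MvPolynomial (Fin 2) ℂ) (hf : ∀ i, (f i).IsHomogeneous (n i))
    (i : Fin s) : comp (ofComp (χ := χ) f hf) i = f i := rfl

theorem eval_dual_smul {V : Type*} [AddCommGroup V] [Module ℂ V] {d : ℕ}
    {f : MvPolynomial (Module.Dual ℂ V) ℂ} (hf : f.IsHomogeneous d) (c : ℂ) (w : V) :
    eval (fun φ : Module.Dual ℂ V => φ (c • w)) f =
      c ^ d * eval (fun φ : Module.Dual ℂ V => φ w) f := by
  have := aeval_mul_of_isHomogeneous hf c (fun φ : Module.Dual ℂ V => φ w)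
  rw [MvPolynomial.aeval_eq_eval, MvPolynomial.aeval_eq_eval] at this
  have h : (fun φ : Module.Dual ℂ V => φ (c • w)) = fun φ => c * φ w :=
    funext fun φ => by rw [map_smul, smul_eq_mul]
  rw [h]
  exact this

theorem eval_dual_rep_eq_zero_iff {V : Type*} [AddCommGroup V] [Module ℂ V] {d : ℕ}
    {f : MvPolynomial (Module.Dual ℂ V) ℂ} (hf : f.IsHomogeneous d) (w : V) (hw : w ≠ 0) :
    eval (fun φ : Module.Dual ℂ V => φ (Projectivization.mk ℂ w hw).rep) f = 0 ↔
      eval (fun φ : Module.Dual ℂ V => φ w) f = 0 := by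
  obtain ⟨c, hc⟩ := Projectivization.exists_smul_eq_mk_rep ℂ w hw
  rw [← hc, Units.smul_def, eval_dual_smul hf]
  simp

theorem mem_zariskiClosure_orbit_iff (v : Mod χ n) (hv : v ≠ 0) (w : Mod χ n) (hw : w ≠ 0) :
    Projectivization.mk ℂ w hw ∈ zariskiClosure
      (MulAction.orbit (Grp k) (Projectivization.mk ℂ v hv)) ↔
    ∀ (d : ℕ) (f : MvPolynomial (Module.Dual ℂ (Mod χ n)) ℂ), f.IsHomogeneous d →
      (∀ g : Grp k, eval (fun φ : Module.Dual ℂ (Mod χ n) => φ (g • v)) f = 0) →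
        eval (fun φ : Module.Dual ℂ (Mod χ n) => φ w) f = 0 := by
  refine forall_congr' fun d => forall_congr' fun f => forall_congr' fun hf => ?_
  rw [eval_dual_rep_eq_zero_iff hf]
  refine imp_congr_left ⟨fun h g => ?_, ?_⟩
  · have := h _ (MulAction.mem_orbit (Projectivization.mk ℂ v hv) g)
    rwa [Projectivization.smul_mk, eval_dual_rep_eq_zero_iff hf] at this
  · rintro h _ ⟨g, rfl⟩
    simp only [Projectivization.smul_mk]
    rw [eval_dual_rep_eq_zero_iff hf]
    exact h g

/-- A linear functional on `V` is a sum of linear functionals of the components. -/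
theorem exists_dual_eq_sum (φ : Module.Dual ℂ (Mod χ n)) :
    ∃ Φ : Fin s → MvPolynomial (Fin 2) ℂ →ₗ[ℂ] ℂ, ∀ w : Mod χ n, φ w = ∑ i, Φ i (comp w i) := by
  let φ' : ((i : Fin s) → homogeneousSubmodule (Fin 2) ℂ (n i)) →ₗ[ℂ] ℂ := φ
  choose Φ hΦ using fun i => LinearMap.exists_extend
    (φ'.comp (LinearMap.single ℂ (fun i : Fin s => homogeneousSubmodule (Fin 2) ℂ (n i)) i))
  refine ⟨Φ, fun w => ?_⟩
  let w' : (i : Fin s) → homogeneousSubmodule (Fin 2) ℂ (n i) := w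
  have h1 : φ w = φ' (∑ i, Pi.single i (w' i)) := (congrArg φ' (Finset.univ_sum_single w')).symm
  rw [h1, map_sum]
  exact Finset.sum_congr rfl fun i _ => (LinearMap.congr_fun (hΦ i) (w i)).symm

theorem subst_diag_eq_sum (z : ℂ) (F : MvPolynomial (Fin 2) ℂ) :
    subst !![1, 0; 0, z] F = ∑ d ∈ F.support, z ^ d 1 • monomial d (coeff d F) := by
  conv_lhs => rw [F.as_sum, map_sum]
  refine Finset.sum_congr rfl fun d _ => ?_
  rw [subst, aeval_monomial, monomial_eq, Finsupp.prod_fintype _ _ (fun _ => pow_zero _),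
    Finsupp.prod_fintype _ _ (fun _ => pow_zero _), Fin.prod_univ_two, Fin.prod_univ_two,
    smul_eq_C_mul, algebraMap_eq]
  simp [mul_pow]
  ring

/-- The limit at `τ = 0` of a curve in the cone over the orbit, of which the coordinates are
polynomials in `τ`, lies in the closure. -/
theorem mem_zariskiClosure_of_limit (v : Mod χ n) (hv : v ≠ 0) (w : Mod χ n) (hw : w ≠ 0)
    (F : Fin s → MvPolynomial (Fin 2) ℂ) (a : Fin s → ℕ) (b : ℕ)
    (h0 : ∀ i, comp w i = C ((0 : ℂ) ^ a i) * subst !![1, 0; 0, 0 ^ b] (F i))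
    (h : ∀ τ : ℂ, τ ≠ 0 → ∃ (c : ℂ) (g : Grp k), ∀ i,
      c • comp (g • v) i = C (τ ^ a i) * subst !![1, 0; 0, τ ^ b] (F i)) :
    Projectivization.mk ℂ w hw ∈ zariskiClosure
      (MulAction.orbit (Grp k) (Projectivization.mk ℂ v hv)) := by
  rw [mem_zariskiClosure_orbit_iff]
  intro d f hf hfv
  have hpoly : ∀ φ : Module.Dual ℂ (Mod χ n), ∃ p : Polynomial ℂ, ∀ (τ : ℂ) (u : Mod χ n),
      (∀ i, comp u i = C (τ ^ a i) * subst !![1, 0; 0, τ ^ b] (F i)) → φ u = p.eval τ := by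
    intro φ
    obtain ⟨Φ, hΦ⟩ := exists_dual_eq_sum φ
    refine ⟨∑ i, ∑ d ∈ (F i).support,
      Polynomial.C (Φ i (monomial d (coeff d (F i)))) * Polynomial.X ^ (a i + b * d 1),
      fun τ u hu => ?_⟩
    rw [hΦ, Polynomial.eval_finsetSum]
    refine Finset.sum_congr rfl fun i _ => ?_
    rw [hu i, subst_diag_eq_sum, ← smul_eq_C_mul, map_smul, map_sum, Polynomial.eval_finsetSum,
      Finset.smul_sum]
    refine Finset.sum_congr rfl fun d _ => ?_
    simp only [map_smul, smul_eq_mul, Polynomial.eval_mul, Polynomial.eval_C, Polynomial.eval_pow,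
      Polynomial.eval_X]
    ring
  choose p hp using hpoly
  have hq : ∀ τ, (aeval p f : Polynomial ℂ).eval τ = eval (fun φ => (p φ).eval τ) f := fun τ => by
    rw [← Polynomial.coe_aeval_eq_eval, ← AlgHom.comp_apply, MvPolynomial.comp_aeval,
      MvPolynomial.aeval_eq_eval]
  have hzero : (aeval p f : Polynomial ℂ) = 0 := by
    refine Polynomial.eq_zero_of_infinite_isRoot _ ((Set.finite_singleton (0 : ℂ)).infinite_compl.mono
      fun τ hτ => ?_)
    obtain ⟨c, g, hcg⟩ := h τ hτ
    rw [Set.mem_ofPred_eq, Polynomial.IsRoot, hq]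
    have : (fun φ => (p φ).eval τ) = fun φ : Module.Dual ℂ (Mod χ n) => φ (c • g • v) :=
      funext fun φ => (hp φ τ (c • g • v) hcg).symm
    rw [this, eval_dual_smul hf, hfv, mul_zero]
  have : (fun φ : Module.Dual ℂ (Mod χ n) => φ w) = fun φ => (p φ).eval 0 :=
    funext fun φ => hp φ 0 w h0
  rw [this, ← hq, hzero, Polynomial.eval_zero]

/-! ### The condition is necessary -/

/-- The limit of `⟨v⟩` along a one-parameter subgroup that selects the face with index set `J`,
after the unipotent substitution `y ↦ z x + y`: its components are `v i (1, z) x ^ n i`. -/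
noncomputable def faceLimit (v : Mod χ n) (J : Finset (Fin s)) (z : ℂ) : Mod χ n :=
  ofComp (fun i => if i ∈ J then C ((dehom (comp v i)).eval z) * X 0 ^ n i else 0) fun i => by
    split_ifs
    · exact isHomogeneous_C_mul_X_pow _ _ _
    · exact isHomogeneous_zero _ _ _

theorem comp_faceLimit (v : Mod χ n) {J : Finset (Fin s)} (z : ℂ) {i : Fin s} (hi : i ∈ J) :
    comp (faceLimit v J z) i = C ((dehom (comp v i)).eval z) * X 0 ^ n i := by
  rw [faceLimit, comp_ofComp, if_pos hi]

theorem faceLimit_ne_zero (v : Mod χ n) {J : Finset (Fin s)} (z : ℂ) {i : Fin s} (hi : i ∈ J)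
    (h : (dehom (comp v i)).eval z ≠ 0) : faceLimit v J z ≠ 0 := by
  intro h0
  have := comp_faceLimit v z hi
  rw [h0, comp_zero] at this
  exact (mul_ne_zero (C_ne_zero.2 h) (pow_ne_zero _ (X_ne_zero 0))) this.symm

/-- Face limits in one orbit have the same monomial invariants. -/
theorem prod_zpow_eq_of_mem_orbit (v : Mod χ n) {J : Finset (Fin s)} {z z' : ℂ}
    (hne : faceLimit v J z ≠ 0) (hne' : faceLimit v J z' ≠ 0)
    (hz' : ∀ i ∈ J, (dehom (comp v i)).eval z' ≠ 0)
    (h : Projectivization.mk ℂ _ hne' ∈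
      MulAction.orbit (Grp k) (Projectivization.mk ℂ _ hne)) (β : Fin s → ℤ)
    (h1 : ∑ i ∈ J, β i = 0) (h2 : ∑ i ∈ J, β i • χ i = 0) (h3 : ∑ i ∈ J, β i * n i = 0) :
    ∏ i ∈ J, (dehom (comp v i)).eval z' ^ β i = ∏ i ∈ J, (dehom (comp v i)).eval z ^ β i := by
  obtain ⟨g, hg⟩ := h
  simp only [Projectivization.smul_mk] at hg
  obtain ⟨c, hc⟩ := (Projectivization.mk_eq_mk_iff ℂ _ _ _ _).1 hg
  have key : ∀ i ∈ J, (c : ℂ) * (dehom (comp v i)).eval z' =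
      (charVal (χ i) g.1 : ℂ) * (g.2.1 0 0 ^ n i * (dehom (comp v i)).eval z) := by
    intro i hi
    have := congrArg (fun u => eval ![1, 0] (comp u i)) hc
    simp only [Units.smul_def, comp_smul, comp_grp_smul, comp_faceLimit v _ hi, smul_eval] at this
    rw [← substR_eq_subst, eval_row_substR] at this
    simpa [mul_comm ((g.2.1 0 0) ^ n i)] using this
  have hκ : ∏ i ∈ J, (g.2.1 0 0 ^ n i) ^ β i = 1 := by
    have hne : ∀ i ∈ J, g.2.1 0 0 ^ n i ≠ 0 := fun i hi h0 => by
      have := key i hi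
      rw [h0, zero_mul, mul_zero] at this
      exact (mul_ne_zero c.ne_zero (hz' i hi)) this
    by_cases h0 : g.2.1 0 0 = 0
    · refine Finset.prod_eq_one fun i hi => ?_
      have := hne i hi
      rw [h0] at this ⊢
      have hn : n i = 0 := by
        by_contra hn
        exact this (zero_pow hn)
      rw [hn, pow_zero, one_zpow]
    · have := prod_monomial_zpow_eq_one J (fun _ : Unit => Units.mk0 _ h0)
        (fun i _ => (n i : ℤ)) β (fun _ => h3)
      simpa using congrArg Units.val this
  have hχ : ∏ i ∈ J, (charVal (χ i) g.1 : ℂ) ^ β i = 1 := by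
    have := prod_monomial_zpow_eq_one J g.1 χ β fun l => by
      simpa using congrFun h2 l
    simpa [charVal] using congrArg Units.val this
  have hc1 : ∏ i ∈ J, (c : ℂ) ^ β i = 1 := by
    have := prod_monomial_zpow_eq_one J (fun _ : Unit => c) (fun _ _ => 1) β (by simpa using h1)
    simpa using congrArg Units.val this
  calc ∏ i ∈ J, (dehom (comp v i)).eval z' ^ β i
      = ∏ i ∈ J, ((c : ℂ) * (dehom (comp v i)).eval z') ^ β i := by
        simp only [mul_zpow, Finset.prod_mul_distrib, hc1, one_mul]
    _ = ∏ i ∈ J, ((charVal (χ i) g.1 : ℂ) * (g.2.1 0 0 ^ n i * (dehom (comp v i)).eval z)) ^ β i :=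
        Finset.prod_congr rfl fun i hi => by rw [key i hi]
    _ = _ := by simp only [mul_zpow, Finset.prod_mul_distrib, hχ, hκ, one_mul]

/-- The matrix of the substitution `y ↦ z x + y`. -/
def unip {R : Type*} [CommRing R] (z : R) : Matrix.SpecialLinearGroup (Fin 2) R :=
  ⟨!![1, z; 0, 1], by simp [Matrix.det_fin_two]⟩

/-- The matrix of the substitution `x ↦ c x`, `y ↦ c⁻¹ y`. -/
def diagSL {K : Type*} [Field K] (c : Kˣ) : Matrix.SpecialLinearGroup (Fin 2) K :=
  ⟨!![(c : K), 0; 0, (c⁻¹ : Kˣ)], by simp [Matrix.det_fin_two]⟩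

/-- An integral vector with `p < 0` on which the weights of the components have their minimum
exactly on `J` exhibits all the `faceLimit v J z` as points of the closure. -/
theorem faceLimit_mem_zariskiClosure (v : Mod χ n) (hv : v ≠ 0) {J : Finset (Fin s)} (r : Fin k → ℤ)
    (p m : ℤ) (hp : p < 0) (hmin : ∀ i, comp v i ≠ 0 → m ≤ ∑ j, χ i j * r j + n i * p)
    (hJ : ∀ i, i ∈ J ↔ comp v i ≠ 0 ∧ ∑ j, χ i j * r j + n i * p = m) (z : ℂ)
    (hne : faceLimit v J z ≠ 0) :
    Projectivization.mk ℂ _ hne ∈ zariskiClosure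
      (MulAction.orbit (Grp k) (Projectivization.mk ℂ v hv)) := by
  refine mem_zariskiClosure_of_limit v hv _ hne (fun i => subst (unip z).1 (comp v i))
    (fun i => (∑ j, χ i j * r j + n i * p - m).toNat) (-2 * p).toNat (fun i => ?_) fun τ hτ => ?_
  · have hb : (0 : ℂ) ^ (-2 * p).toNat = 0 := zero_pow (by omega)
    rw [hb]
    by_cases hi : i ∈ J
    · have h0 : (∑ j, χ i j * r j + n i * p - m).toNat = 0 := by
        rw [((hJ i).1 hi).2, sub_self, Int.toNat_zero]
      rw [comp_faceLimit v z hi, h0, pow_zero, C_1, one_mul, ← substR_eq_subst, ← substR_eq_subst,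
        ← substR_mul_apply]
      have hmat : !![1, 0; 0, 0] * (unip z).1 = Matrix.of ![![1, z], 0] := by
        ext a b
        fin_cases a <;> fin_cases b <;> simp [unip, Matrix.mul_apply]
      rw [hmat, substR_row _ (comp_isHomogeneous v i), eval_dehom]
    · rw [faceLimit, comp_ofComp, if_neg hi]
      by_cases hvi : comp v i = 0
      · rw [hvi, map_zero, map_zero, mul_zero]
      · have h1 := hmin i hvi
        have h2 : ∑ j, χ i j * r j + n i * p ≠ m := fun h => hi ((hJ i).2 ⟨hvi, h⟩)
        rw [zero_pow (by omega), C_0, zero_mul]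
  · let u : ℂˣ := Units.mk0 τ hτ
    refine ⟨τ ^ (-m), (fun j => u ^ r j, diagSL (u ^ p) * unip z), fun i => ?_⟩
    by_cases hvi : comp v i = 0
    · simp [comp_grp_smul, hvi]
    have hmat : (diagSL (u ^ p)).1 = τ ^ p • !![1, 0; 0, τ ^ (-2 * p).toNat] := by
      have hpow : τ ^ (-2 * p).toNat = τ ^ (-2 * p) := by
        rw [← zpow_natCast]
        congr 1
        omega
      ext a b
      fin_cases a <;> fin_cases b
      · simp [diagSL, u]
      · simp [diagSL]
      · simp [diagSL]
      · simp only [diagSL, u, hpow]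
        simp [← zpow_add₀ hτ, ← zpow_neg]
        congr 1
        omega
    have hχ : ((charVal (χ i) fun j => u ^ r j : ℂˣ) : ℂ) = τ ^ ∑ j, χ i j * r j := by
      have : (charVal (χ i) fun j => u ^ r j) = u ^ ∑ j, χ i j * r j := by
        simp only [charVal, ← zpow_mul, prod_zpow_const, mul_comm]
      rw [this, Units.val_zpow_eq_zpow_val, Units.val_mk0]
    have hpow : τ ^ (∑ j, χ i j * r j + n i * p - m).toNat =
        τ ^ (-m) * τ ^ (∑ j, χ i j * r j) * (τ ^ p) ^ n i := by
      rw [← zpow_natCast, ← zpow_natCast, ← zpow_mul, ← zpow_add₀ hτ, ← zpow_add₀ hτ]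
      congr 1
      have := hmin i hvi
      rw [Int.toNat_of_nonneg (by omega)]
      ring
    rw [comp_grp_smul, hχ, hpow, Matrix.SpecialLinearGroup.coe_mul, ← substR_eq_subst,
      substR_mul_apply, hmat, substR_smul (τ ^ p) _ (F := substR (unip z).1 (comp v i))
        (subst_isHomogeneous _ (comp_isHomogeneous v i)),
      smul_smul, smul_eq_C_mul]
    simp only [map_mul, substR_eq_subst, mul_assoc]

/-- The condition is necessary, for all admissible faces. -/
theorem sum_mult_eq_zero_of_finite (v : Mod χ n) (hv : v ≠ 0)
    (hfin : {O : Set (ℙ ℂ (Mod χ n)) | ∃ P ∈ zariskiClosure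
      (MulAction.orbit (Grp k) (Projectivization.mk ℂ v hv)),
        O = MulAction.orbit (Grp k) P}.Finite)
    {F : Set ((Fin k → ℚ) × ℚ)} (hF : IsAdmissible (polyhedron v) F) (β : Fin s → ℤ)
    (hβχ : ∑ i ∈ faceIndices v F, β i • χ i = 0) (hβ : ∑ i ∈ faceIndices v F, β i = 0) (a : ℂ) :
    ∑ i ∈ faceIndices v F, (mult v i a : ℤ) * β i = 0 := by
  classical
  obtain ⟨-, R, m, hR, hm, hFeq⟩ := (isAdmissible_iff (convex_convexHull ℚ _)).1 hF
  have hFmem : ∀ u, u ∈ F ↔ u ∈ polyhedron v ∧ scal u R = m := fun u => by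
    rw [hFeq]
    rfl
  set J := faceIndices v F with hJdef
  have hJ : ∀ i, i ∈ J ↔ comp v i ≠ 0 ∧ charPoint χ n i ∈ F := fun i => by
    simp [hJdef, faceIndices]
  have hK : ∀ i, comp v i ≠ 0 → charPoint χ n i ∈ polyhedron v := fun i hi =>
    subset_convexHull ℚ _ ⟨i, hi, rfl⟩
  rcases J.eq_empty_or_nonempty with hJ0 | ⟨i₀, hi₀⟩
  · rw [hJ0, Finset.sum_empty]
  obtain ⟨d, b, hd, hb⟩ := exists_common_denominator fun l : Option (Fin k) => l.elim R.2 R.1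
  let w : Fin s → ℤ := fun i => ∑ j, χ i j * b (some j) + n i * b none
  have hw : ∀ i, (w i : ℚ) = d * scal (charPoint χ n i) R := by
    intro i
    simp only [w, scal, charPoint]
    push_cast
    simp only [hb, Option.elim, mul_add, Finset.mul_sum]
    congr 1
    · exact Finset.sum_congr rfl fun j _ => by ring
    · ring
  have hd' : (0 : ℚ) < d := by exact_mod_cast hd
  have hw₀ : ∀ i, i ∈ J → (w i : ℚ) = d * m := fun i hi => by
    rw [hw, ((hFmem _).1 ((hJ i).1 hi).2).2]
  have hp : b none < 0 := by
    have h1 : (b none : ℚ) < 0 := by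
      rw [hb]
      exact mul_neg_of_pos_of_neg hd' hR
    exact_mod_cast h1
  have hmin : ∀ i, comp v i ≠ 0 → w i₀ ≤ w i := fun i hi => by
    have h1 : (w i₀ : ℚ) ≤ w i := by
      rw [hw₀ i₀ hi₀, hw]
      exact mul_le_mul_of_nonneg_left (hm _ (hK i hi)) hd'.le
    exact_mod_cast h1
  have hJw : ∀ i, i ∈ J ↔ comp v i ≠ 0 ∧ w i = w i₀ := by
    intro i
    rw [hJ]
    refine and_congr_right fun hi => ⟨fun h => ?_, fun h => (hFmem _).2 ⟨hK i hi, ?_⟩⟩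
    · have h1 : (w i : ℚ) = w i₀ := by rw [hw₀ i ((hJ i).2 ⟨hi, h⟩), hw₀ i₀ hi₀]
      exact_mod_cast h1
    · have h1 : (w i : ℚ) = w i₀ := by rw [h]
      rw [hw, hw₀ i₀ hi₀] at h1
      exact mul_left_cancel₀ hd'.ne' h1
  -- on the face, the relation among the characters is also one among the degrees
  have hβn : ∑ i ∈ J, β i * n i = 0 := by
    have h1 : ∑ i ∈ J, β i * w i = 0 := by
      rw [Finset.sum_congr rfl fun i hi => by rw [((hJw i).1 hi).2], ← Finset.sum_mul, hβ, zero_mul]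
    have h2 : ∑ i ∈ J, β i * ∑ j, χ i j * b (some j) = 0 := by
      simp only [Finset.mul_sum]
      rw [Finset.sum_comm]
      refine Finset.sum_eq_zero fun j _ => ?_
      have := congrFun hβχ j
      simp only [Finset.sum_apply, Pi.smul_apply, smul_eq_mul, Pi.zero_apply] at this
      simp only [← mul_assoc, ← Finset.sum_mul, this, zero_mul]
    simp only [w, mul_add, Finset.sum_add_distrib, h2, zero_add, ← mul_assoc,
      ← Finset.sum_mul] at h1
    exact (mul_eq_zero.1 h1).resolve_right hp.ne
  have hf : ∀ i ∈ J, dehom (comp v i) ≠ 0 := fun i hi =>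
    dehom_ne_zero (comp_isHomogeneous v i) ((hJ i).1 hi).1
  let Λ : Set ℂ := {z | ∀ i ∈ J, (dehom (comp v i)).eval z ≠ 0}
  have hΛ : Λ.Infinite := by
    have hprod : ∏ i ∈ J, dehom (comp v i) ≠ 0 := Finset.prod_ne_zero_iff.2 hf
    refine Set.Infinite.mono (fun z hz => ?_)
      (Polynomial.finite_setOfPred_isRoot hprod).infinite_compl
    intro i hi h0
    apply hz
    rw [Set.mem_ofPred_eq, Polynomial.IsRoot, Polynomial.eval_prod]
    exact Finset.prod_eq_zero hi h0
  have hne : ∀ z ∈ Λ, faceLimit v J z ≠ 0 := fun z hz => faceLimit_ne_zero v z hi₀ (hz i₀ hi₀)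
  let O : ℂ → Set (ℙ ℂ (Mod χ n)) := fun z =>
    if h : faceLimit v J z ≠ 0 then MulAction.orbit (Grp k) (Projectivization.mk ℂ _ h) else ∅
  have hO : ∀ z (hz : z ∈ Λ), O z = MulAction.orbit (Grp k) (Projectivization.mk ℂ _ (hne z hz)) :=
    fun z hz => dif_pos (hne z hz)
  -- infinitely many of these limits lie in one orbit
  obtain ⟨z₀, hz₀, hinf⟩ : ∃ z₀ ∈ Λ, (Λ ∩ O ⁻¹' {O z₀}).Infinite := by
    by_contra! hcon
    refine hΛ (Set.Finite.of_finite_fibers O (hfin.subset ?_) ?_)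
    · rintro _ ⟨z, hz, rfl⟩
      exact ⟨_, faceLimit_mem_zariskiClosure v hv (fun j => b (some j)) (b none) (w i₀) hp hmin hJw
        z (hne z hz), hO z hz⟩
    · rintro _ ⟨z, hz, rfl⟩
      exact hcon z hz
  have := sum_eq_zero_of_prod_zpow_eval_eq J (fun i => dehom (comp v i)) hf β
    (∏ i ∈ J, (dehom (comp v i)).eval z₀ ^ β i) hinf (fun z hz => hz.1) (by
      rintro z ⟨hz1, hz2⟩
      have hz2 : O z = O z₀ := hz2
      rw [hO z hz1, hO z₀ hz₀] at hz2
      exact prod_zpow_eq_of_mem_orbit v (hne z₀ hz₀) (hne z hz1) hz1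
        (MulAction.orbit_eq_iff.1 hz2) β hβ hβχ hβn) (-a)
  rw [← this]
  exact Finset.sum_congr rfl fun i hi => by rw [mult_eq_rootMultiplicity v ((hJ i).1 hi).1]

/-! ### A place centered at a point of the closure -/

/-- The coefficient of a monomial in a component, as a linear functional. -/
noncomputable def coeffFunctional (i : Fin s) (m : Fin 2 →₀ ℕ) : Module.Dual ℂ (Mod χ n) where
  toFun w := coeff m (comp w i)
  map_add' w w' := by rw [comp_add, coeff_add]
  map_smul' c w := by rw [comp_smul, coeff_smul, RingHom.id_apply]

/-- A polynomial, homogeneous or not, that does not vanish at a point `w` of the cone over the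
closure does not vanish identically on the cone over the orbit. -/
theorem exists_eval_ne_zero (v : Mod χ n) (hv : v ≠ 0) (w : Mod χ n) (hw : w ≠ 0)
    (h : Projectivization.mk ℂ w hw ∈ zariskiClosure
      (MulAction.orbit (Grp k) (Projectivization.mk ℂ v hv)))
    (f : MvPolynomial (Module.Dual ℂ (Mod χ n)) ℂ)
    (hf : eval (fun φ : Module.Dual ℂ (Mod χ n) => φ w) f ≠ 0) :
    ∃ x : ℂˣ × Grp k, eval (fun φ : Module.Dual ℂ (Mod χ n) => φ ((x.1 : ℂ) • x.2 • v)) f ≠ 0 := by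
  rw [mem_zariskiClosure_orbit_iff] at h
  by_contra! hcon
  apply hf
  rw [← sum_homogeneousComponent f, map_sum]
  refine Finset.sum_eq_zero fun d hd => h d _ (homogeneousComponent_isHomogeneous d f) fun g => ?_
  let q : Polynomial ℂ := ∑ d ∈ Finset.range (f.totalDegree + 1),
    Polynomial.C (eval (fun φ : Module.Dual ℂ (Mod χ n) => φ (g • v)) (homogeneousComponent d f)) *
      Polynomial.X ^ d
  have hq : q = 0 := by
    refine Polynomial.eq_zero_of_infinite_isRoot _
      ((Set.finite_singleton (0 : ℂ)).infinite_compl.mono fun c hc => ?_)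
    rw [Set.mem_ofPred_eq, Polynomial.IsRoot, Polynomial.eval_finsetSum]
    have h1 := hcon (Units.mk0 c hc, g)
    rw [← sum_homogeneousComponent f, map_sum] at h1
    rw [← h1]
    refine Finset.sum_congr rfl fun d _ => ?_
    rw [eval_dual_smul (homogeneousComponent_isHomogeneous d f), Polynomial.eval_mul,
      Polynomial.eval_C, Polynomial.eval_pow, Polynomial.eval_X]
    exact mul_comm _ _
  have h2 : q.coeff d = 0 := by rw [hq, Polynomial.coeff_zero]
  simpa only [q, Polynomial.finsetSum_coeff, Polynomial.coeff_C_mul_X_pow, Finset.sum_ite_eq,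
    if_pos hd] using h2

/-- The filter generated by the sets of the parameters `(c, g)` with `f (c g v) ≠ 0`, for the
polynomials `f` with `f w ≠ 0`. -/
def closureFilter (v : Mod χ n) (w : Mod χ n) : Filter (ℂˣ × Grp k) where
  sets := {U | ∃ f : MvPolynomial (Module.Dual ℂ (Mod χ n)) ℂ,
    eval (fun φ : Module.Dual ℂ (Mod χ n) => φ w) f ≠ 0 ∧ ∀ x : ℂˣ × Grp k,
      eval (fun φ : Module.Dual ℂ (Mod χ n) => φ ((x.1 : ℂ) • x.2 • v)) f ≠ 0 → x ∈ U}
  univ_sets := ⟨1, by simp, fun _ _ => trivial⟩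
  sets_of_superset := fun ⟨f, hf, hU⟩ hUV => ⟨f, hf, fun x hx => hUV (hU x hx)⟩
  inter_sets := fun ⟨f, hf, hU⟩ ⟨f', hf', hU'⟩ => ⟨f * f', by
    rw [map_mul]
    exact mul_ne_zero hf hf', fun x hx => by
      rw [map_mul] at hx
      exact ⟨hU x (left_ne_zero_of_mul hx), hU' x (right_ne_zero_of_mul hx)⟩⟩

/-- Every point `⟨w⟩` of the closure of the orbit is the value, at some place of some field `K`, of
a point of the orbit with coordinates in `K`. The field is an ultraproduct: it is the field of
germs of functions on the parameters `(c, g)` along an ultrafilter finer than `closureFilter`, and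
the point of the orbit is the germ of `c g v`. -/
theorem exists_place (v : Mod χ n) (hv : v ≠ 0) (w : Mod χ n) (hw : w ≠ 0)
    (h : Projectivization.mk ℂ w hw ∈ zariskiClosure
      (MulAction.orbit (Grp k) (Projectivization.mk ℂ v hv))) :
    ∃ (K : Type) (_ : Field K) (_ : Algebra ℂ K) (p : Place K) (c : Kˣ) (t : Fin k → Kˣ)
      (g : Matrix (Fin 2) (Fin 2) K), g.det = 1 ∧ ∀ i,
      p.LimPoly (C ((c * ∏ j, t j ^ χ i j : Kˣ) : K) *
        substR g (MvPolynomial.map (algebraMap ℂ K) (comp v i))) (comp w i) := by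
  let α := ℂˣ × Grp k
  have hne : (closureFilter v w).NeBot := by
    rw [Filter.neBot_iff, Ne, ← Filter.empty_mem_iff_bot]
    rintro ⟨f, hf, hf'⟩
    obtain ⟨x, hx⟩ := exists_eval_ne_zero v hv w hw h f hf
    exact hf' x hx
  let U : Ultrafilter α := Ultrafilter.of (closureFilter v w)
  have hU : (U : Filter α) ≤ closureFilter v w := Ultrafilter.of_le _
  let K := Filter.Germ (U : Filter α) ℂ
  let φ : (α → ℂ) →+* K := Filter.Germ.coeRingHom (U : Filter α)
  let _ : Algebra ℂ K := (φ.comp (Pi.constRingHom α ℂ)).toAlgebra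
  have halg : (algebraMap ℂ K) = φ.comp (Pi.constRingHom α ℂ) := rfl
  let φA : (α → ℂ) →ₐ[ℂ] K := { φ with commutes' := fun r => rfl }
  let pt : α → Mod χ n := fun x => (x.1 : ℂ) • x.2 • v
  let Ψ : MvPolynomial (Module.Dual ℂ (Mod χ n)) ℂ →ₐ[ℂ] K × ℂ :=
    (φA.comp (aeval fun ψ x => ψ (pt x))).prod (aeval fun ψ => ψ w)
  obtain ⟨p, hp⟩ := Place.exists_of_subalgebra Ψ.range (by
    rintro a ⟨f, hf⟩
    have h1 : φ (aeval (fun (ψ : Module.Dual ℂ (Mod χ n)) (x : α) => ψ (pt x)) f) = 0 :=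
      congrArg Prod.fst hf
    have h2 : aeval (fun ψ : Module.Dual ℂ (Mod χ n) => ψ w) f = a := congrArg Prod.snd hf
    by_contra ha
    rw [← h2, MvPolynomial.aeval_eq_eval] at ha
    have h3 : {x : α | eval (fun ψ : Module.Dual ℂ (Mod χ n) => ψ (pt x)) f ≠ 0} ∈
        (U : Filter α) := hU ⟨f, ha, fun x hx => hx⟩
    have h4 : ∀ᶠ x in (U : Filter α),
        aeval (fun (ψ : Module.Dual ℂ (Mod χ n)) (x : α) => ψ (pt x)) f x = 0 :=
      Filter.Germ.coe_eq.1 h1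
    obtain ⟨x, hx3, hx4⟩ := (Filter.inter_mem h3 h4 : _ ∈ (U : Filter α)) |> U.neBot.nonempty_of_mem
    apply hx3
    rw [← hx4]
    have : (Pi.evalAlgHom ℂ (fun _ : α => ℂ) x)
        (aeval (fun (ψ : Module.Dual ℂ (Mod χ n)) (x : α) => ψ (pt x)) f) =
        eval (fun ψ : Module.Dual ℂ (Mod χ n) => ψ (pt x)) f := by
      rw [← AlgHom.comp_apply, MvPolynomial.comp_aeval, MvPolynomial.aeval_eq_eval]
      rfl
    exact this.symm)
  let cF : (α → ℂ)ˣ := MulEquiv.piUnits.symm fun x : α => x.1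
  let tF : Fin k → (α → ℂ)ˣ := fun j => MulEquiv.piUnits.symm fun x : α => x.2.1 j
  let gF : Matrix (Fin 2) (Fin 2) (α → ℂ) := fun a b x => x.2.2.1 a b
  refine ⟨K, inferInstance, inferInstance, p, Units.map φ cF, fun j => Units.map φ (tF j),
    φ.mapMatrix gF, ?_, fun i => ?_⟩
  · rw [← RingHom.map_det]
    have : gF.det = 1 := by
      ext x
      have := x.2.2.2
      rw [Matrix.det_fin_two] at this ⊢
      exact this
    rw [this, map_one]
  · let S : MvPolynomial (Fin 2) (α → ℂ) := C ((cF * ∏ j, tF j ^ χ i j : (α → ℂ)ˣ) : α → ℂ) *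
      substR gF (MvPolynomial.map (Pi.constRingHom α ℂ) (comp v i))
    have hSx : ∀ x, MvPolynomial.map (Pi.evalRingHom (fun _ : α => ℂ) x) S = comp (pt x) i := by
      intro x
      have e1 : ((Pi.evalRingHom (fun _ : α => ℂ) x).comp (Pi.constRingHom α ℂ)) = RingHom.id ℂ :=
        rfl
      have e2 : Pi.evalRingHom (fun _ : α => ℂ) x ((cF * ∏ j, tF j ^ χ i j : (α → ℂ)ˣ) : α → ℂ) =
          (x.1 : ℂ) * (charVal (χ i) x.2.1 : ℂ) := by
        have : (Units.map (Pi.evalRingHom (fun _ : α => ℂ) x).toMonoidHom)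
          (cF * ∏ j, tF j ^ χ i j) = x.1 * charVal (χ i) x.2.1 := by
          rw [map_mul, map_prod, charVal]
          refine congrArg₂ (· * ·) (Units.ext rfl) (Finset.prod_congr rfl fun j _ => ?_)
          rw [map_zpow]
          exact congrArg (· ^ χ i j) (Units.ext rfl)
        simpa using congrArg Units.val this
      rw [map_mul, map_C, map_substR, MvPolynomial.map_map, e1, MvPolynomial.map_id, e2,
        comp_smul, comp_grp_smul, smul_smul, smul_eq_C_mul]
      rfl
    have hSφ : MvPolynomial.map φ S = C ((Units.map φ cF * ∏ j, Units.map φ (tF j) ^ χ i j : Kˣ) : K) *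
        substR (φ.mapMatrix gF) (MvPolynomial.map (algebraMap ℂ K) (comp v i)) := by
      rw [map_mul, map_C, map_substR, MvPolynomial.map_map, halg]
      congr 2
      have : Units.map (φ : (α → ℂ) →* K) (cF * ∏ j, tF j ^ χ i j) =
          Units.map φ cF * ∏ j, Units.map φ (tF j) ^ χ i j := by
        rw [map_mul, map_prod]
        simp only [map_zpow]
      exact congrArg Units.val this
    rw [← hSφ]
    refine Place.limPoly_of_coeff fun m => hp ⟨X (coeffFunctional i m), ?_⟩
    refine Prod.ext ?_ ?_
    · rw [coeff_map]
      change φ (aeval (fun (ψ : Module.Dual ℂ (Mod χ n)) (x : α) => ψ (pt x))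
        (X (coeffFunctional i m))) = _
      rw [aeval_X]
      congr 1
      ext x
      change coeff m (comp (pt x) i) = _
      rw [← hSx, coeff_map]
      rfl
    · change aeval (fun ψ : Module.Dual ℂ (Mod χ n) => ψ w) (X (coeffFunctional i m)) = _
      rw [aeval_X]
      rfl

/-! ### Normal forms of matrices over a field with a place -/

/-- The matrices that move the points of the projective line to `(1 : 0)`: `some z` stands for the
point `(1 : z)`, and `none` for the point at infinity `(0 : 1)`. -/
def dirMat : Option ℂ → Matrix.SpecialLinearGroup (Fin 2) ℂ
  | none => ⟨!![0, 1; -1, 0], by simp [Matrix.det_fin_two]⟩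
  | some z => unip z

section Normal

variable {K : Type*} [Field K] [Algebra ℂ K] (p : Place K)

/-- The matrix `b` is the product of a matrix with finite entries, of which the value at the place
is in `SL₂(ℂ)`, and of `g`. -/
def Reduces (g b : Matrix (Fin 2) (Fin 2) K) : Prop :=
  ∃ (h : Matrix (Fin 2) (Fin 2) K) (h₀ : Matrix.SpecialLinearGroup (Fin 2) ℂ),
    (∀ i j, p.Lim (h i j) (h₀.1 i j)) ∧ h * g = b

variable {p}

theorem Reduces.trans {a b c : Matrix (Fin 2) (Fin 2) K} (h : Reduces p a b)
    (h' : Reduces p b c) : Reduces p a c := by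
  obtain ⟨x, x₀, hx, rfl⟩ := h
  obtain ⟨y, y₀, hy, rfl⟩ := h'
  refine ⟨y * x, y₀ * x₀, fun i j => ?_, mul_assoc _ _ _⟩
  rw [Matrix.SpecialLinearGroup.coe_mul, Matrix.mul_apply, Matrix.mul_apply, Fin.sum_univ_two,
    Fin.sum_univ_two]
  exact ((hy i 0).mul (hx 0 j)).add ((hy i 1).mul (hx 1 j))

theorem Reduces.of_eq {g : Matrix (Fin 2) (Fin 2) K} (x y z u : K) {x₀ y₀ z₀ u₀ : ℂ}
    (hx : p.Lim x x₀) (hy : p.Lim y y₀) (hz : p.Lim z z₀) (hu : p.Lim u u₀)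
    (hdet : x₀ * u₀ - y₀ * z₀ = 1) {b : Matrix (Fin 2) (Fin 2) K} (hb : !![x, y; z, u] * g = b) :
    Reduces p g b := by
  refine ⟨_, ⟨!![x₀, y₀; z₀, u₀], by rw [Matrix.det_fin_two_of, hdet]⟩, fun i j => ?_, hb⟩
  fin_cases i <;> fin_cases j <;> assumption

/-- The Iwasawa decomposition: row operations over the valuation ring make a matrix
triangular. -/
theorem exists_reduces_triangular {g : Matrix (Fin 2) (Fin 2) K} (hg : g.det = 1) :
    ∃ κ l : K, κ ≠ 0 ∧ Reduces p g !![κ, l; 0, κ⁻¹] := by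
  rw [Matrix.det_fin_two] at hg
  have hcase : (g 0 0 ≠ 0 ∧ ∃ a, p.Lim (g 1 0 / g 0 0) a) ∨
      (g 1 0 ≠ 0 ∧ ∃ a, p.Lim (g 0 0 / g 1 0) a) := by
    by_cases h0 : g 0 0 = 0
    · refine Or.inr ⟨fun h1 => ?_, 0, ?_⟩
      · rw [h0, h1] at hg
        simp at hg
      · rw [h0, zero_div]
        exact Place.lim_zero p
    · rcases Place.lim_or_inv p (g 1 0 / g 0 0) with h | h
      · exact Or.inl ⟨h0, h⟩
      · by_cases h1 : g 1 0 = 0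
        · refine Or.inl ⟨h0, 0, ?_⟩
          rw [h1, zero_div]
          exact Place.lim_zero p
        · rw [inv_div] at h
          exact Or.inr ⟨h1, 0, h⟩
  rcases hcase with ⟨h0, a, ha⟩ | ⟨h0, a, ha⟩
  · refine ⟨g 0 0, g 0 1, h0, Reduces.of_eq 1 0 (-(g 1 0 / g 0 0)) 1 (Place.lim_one p)
      (Place.lim_zero p) ha.neg (Place.lim_one p) (by ring) ?_⟩
    ext i j
    fin_cases i <;> fin_cases j <;> simp [Matrix.mul_apply, Fin.sum_univ_two] <;> field_simp
    · ring
    · linear_combination hg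
  · refine ⟨g 1 0, g 1 1, h0, Reduces.of_eq 0 1 (-1) (g 0 0 / g 1 0) (Place.lim_zero p)
      (Place.lim_one p) (Place.lim_one p).neg ha (by ring) ?_⟩
    ext i j
    fin_cases i <;> fin_cases j <;> simp [Matrix.mul_apply, Fin.sum_univ_two] <;> field_simp
    · ring
    · linear_combination hg

theorem lim_zero_of_sq {x : K} (h : p.Lim (x ^ 2) 0) : p.Lim x 0 := by
  rcases Place.lim_or_inv p x with ⟨a, ha⟩ | h'
  · have := (ha.pow 2).unique h
    rw [pow_eq_zero_iff two_ne_zero] at this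
    rwa [this] at ha
  · by_cases hx : x = 0
    · rw [hx]
      exact Place.lim_zero p
    · have := h.mul (h'.pow 2)
      rw [inv_pow, mul_inv_cancel₀ (pow_ne_zero 2 hx), zero_mul] at this
      exact absurd ((Place.lim_one p).unique this) one_ne_zero

/-- The matrix `g` reduces to `!![κ, 0; 0, κ⁻¹]` or `!![κ, κ ε; 0, κ⁻¹]`, times a matrix `dirMat o`;
here `κ` and `κ² ε` are infinite at the place, and `ε` is infinitesimal. -/
def IsNormal (p : Place K) (g : Matrix (Fin 2) (Fin 2) K) : Prop :=
  ∃ (o : Option ℂ) (κ : K), κ ≠ 0 ∧ p.Lim κ⁻¹ 0 ∧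
    (Reduces p g (!![κ, 0; 0, κ⁻¹] * (algebraMap ℂ K).mapMatrix (dirMat o).1) ∨
      ∃ ε : K, ε ≠ 0 ∧ p.Lim ε 0 ∧ p.Lim (κ ^ 2 * ε)⁻¹ 0 ∧
        Reduces p g (!![κ, κ * ε; 0, κ⁻¹] * (algebraMap ℂ K).mapMatrix (dirMat o).1))

theorem isNormal_of_reduces {g : Matrix (Fin 2) (Fin 2) K} (o : Option ℂ) {κ ε : K} (hκ : κ ≠ 0)
    (hκ' : p.Lim κ⁻¹ 0) (hε : p.Lim ε 0)
    (h : Reduces p g (!![κ, κ * ε; 0, κ⁻¹] * (algebraMap ℂ K).mapMatrix (dirMat o).1)) :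
    IsNormal p g := by
  refine ⟨o, κ, hκ, hκ', ?_⟩
  rcases Place.lim_or_inv p (κ ^ 2 * ε) with ⟨a, ha⟩ | hinv
  · refine Or.inl (h.trans (Reduces.of_eq 1 (-(κ ^ 2 * ε)) 0 1 (Place.lim_one p) ha.neg
      (Place.lim_zero p) (Place.lim_one p) (by ring) ?_))
    rw [← mul_assoc]
    congr 1
    ext i j
    fin_cases i <;> fin_cases j <;> simp [Matrix.mul_apply, Fin.sum_univ_two]
    field_simp
    ring
  · by_cases hε0 : ε = 0
    · rw [hε0, mul_zero] at h
      exact Or.inl h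
    · exact Or.inr ⟨ε, hε0, hε, hinv, h⟩

/-- Up to multiplication by matrices over the valuation ring from the left, a matrix of
determinant 1 is the identity or one of two simple matrices times a matrix `dirMat o`, which
carries the limit of its first row to `(1 : 0)`. -/
theorem reduces_one_or_isNormal {g : Matrix (Fin 2) (Fin 2) K} (hg : g.det = 1) :
    Reduces p g 1 ∨ IsNormal p g := by
  obtain ⟨κ, l, hκ, hred⟩ := exists_reduces_triangular (p := p) hg
  have hswap : Reduces p !![κ, l; 0, κ⁻¹] (!![κ⁻¹, 0; 0, κ⁻¹⁻¹] *
      (algebraMap ℂ K).mapMatrix (dirMat none).1) ∨ ¬ ∃ a, p.Lim (κ * l) a := by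
    by_cases h : ∃ a, p.Lim (κ * l) a
    · obtain ⟨a, ha⟩ := h
      refine Or.inl (Reduces.of_eq 0 1 (-1) (κ * l) (Place.lim_zero p) (Place.lim_one p)
        (Place.lim_one p).neg ha (by ring) ?_)
      ext i j
      fin_cases i <;> fin_cases j <;> simp [dirMat, Matrix.mul_apply, Fin.sum_univ_two]
      field_simp
      ring
    · exact Or.inr h
  have hcase : (∃ z, p.Lim (l / κ) z) ∨ (l ≠ 0 ∧ p.Lim (κ / l) 0) := by
    by_cases hl : l = 0
    · refine Or.inl ⟨0, ?_⟩
      rw [hl, zero_div]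
      exact Place.lim_zero p
    · rcases Place.lim_or_inv p (l / κ) with h | h
      · exact Or.inl h
      · rw [inv_div] at h
        exact Or.inr ⟨hl, h⟩
  rcases hcase with ⟨z, hz⟩ | ⟨hl, hz⟩
  · have hε : p.Lim (l / κ - algebraMap ℂ K z) 0 := by
      have := hz.add (Place.lim_algebraMap p z).neg
      rwa [← sub_eq_add_neg, add_neg_cancel] at this
    by_cases hfin : ∃ a, p.Lim κ a
    · obtain ⟨a, ha⟩ := hfin
      have hl : p.Lim l (z * a) := by
        have := hz.mul ha
        rwa [div_mul_cancel₀ _ hκ] at this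
      by_cases ha0 : a = 0
      · -- the second row dominates
        rw [ha0] at ha
        exact Or.inr ⟨none, κ⁻¹, inv_ne_zero hκ, by rwa [inv_inv], Or.inl (hred.trans
          (hswap.resolve_right fun h => h ⟨_, ha.mul hl⟩))⟩
      · left
        refine hred.trans (Reduces.of_eq κ⁻¹ (-l) 0 κ (ha.inv ha0) hl.neg (Place.lim_zero p) ha
          (by field_simp; ring) ?_)
        ext i j
        fin_cases i <;> fin_cases j <;> simp [Matrix.mul_apply, Fin.sum_univ_two, hκ]
        field_simp
        ring
    · have hκ' : p.Lim κ⁻¹ 0 := (Place.lim_or_inv p κ).resolve_left hfin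
      refine Or.inr (isNormal_of_reduces (some z) hκ hκ' hε ?_)
      convert hred using 1
      ext i j
      fin_cases i <;> fin_cases j <;> simp [dirMat, unip, Matrix.mul_apply, Fin.sum_univ_two]
      field_simp
      ring
  · -- the first row tends to the point at infinity
    right
    rcases Place.lim_or_inv p (κ⁻¹ / l) with ⟨a, ha⟩ | hinv
    · have hl' : p.Lim l⁻¹ 0 := by
        refine lim_zero_of_sq ?_
        have := ha.mul hz
        rw [mul_zero] at this
        convert this using 1
        field_simp
      have hε : p.Lim (-(κ / l)) 0 := by simpa using hz.neg
      refine isNormal_of_reduces none hl hl' hε (hred.trans (Reduces.of_eq 1 0 (-(κ⁻¹ / l)) 1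
        (Place.lim_one p) (Place.lim_zero p) ha.neg (Place.lim_one p) (by ring) ?_))
      ext i j
      fin_cases i <;> fin_cases j <;> simp [dirMat, Matrix.mul_apply, Fin.sum_univ_two] <;>
        field_simp
      ring
    · rw [inv_div, div_inv_eq_mul, mul_comm] at hinv
      have hκ0 : p.Lim κ 0 := by
        refine lim_zero_of_sq ?_
        have := hinv.mul hz
        rw [mul_zero] at this
        convert this using 1
        field_simp
      exact ⟨none, κ⁻¹, inv_ne_zero hκ, by rwa [inv_inv], Or.inl (hred.trans
        (hswap.resolve_right fun h => h ⟨_, hinv⟩))⟩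

end Normal

/-! ### Limits of monomials -/

section Limits

variable {K : Type*} [Field K] [Algebra ℂ K] {p : Place K}

theorem limPoly_substR {h : Matrix (Fin 2) (Fin 2) K} {h₀ : Matrix (Fin 2) (Fin 2) ℂ}
    (hh : ∀ i j, p.Lim (h i j) (h₀ i j)) {P : MvPolynomial (Fin 2) K} {Q : MvPolynomial (Fin 2) ℂ}
    (hPQ : p.LimPoly P Q) : p.LimPoly (substR h P) (subst h₀ Q) := by
  obtain ⟨S, rfl, rfl⟩ := hPQ
  let M : Matrix (Fin 2) (Fin 2) p.graph := Matrix.of fun i j => ⟨(h i j, h₀ i j), hh i j⟩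
  exact ⟨substR M S, map_substR _ M S, map_substR _ M S⟩

theorem prod_zpow_eq_one_of_lim {ι : Type*} {J : Finset ι} {σ : ι → K} {γ : ι → ℂ}
    (h : ∀ i ∈ J, p.Lim (σ i) (γ i)) (hγ : ∀ i ∈ J, γ i ≠ 0) {β : ι → ℤ}
    (hσ : ∏ i ∈ J, σ i ^ β i = 1) : ∏ i ∈ J, γ i ^ β i = 1 := by
  have h1 := Place.Lim.prod J fun i hi => (h i hi).zpow (hγ i hi) (β i)
  rw [hσ] at h1
  exact h1.unique (Place.lim_one p)

/-- If a monomial in elements with nonzero values is a power of an infinitesimal, then it is the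
zeroth power. -/
theorem prod_zpow_eq_one_of_lim_of_zpow {ι : Type*} {J : Finset ι} {σ : ι → K} {γ : ι → ℂ}
    (h : ∀ i ∈ J, p.Lim (σ i) (γ i)) (hγ : ∀ i ∈ J, γ i ≠ 0) {β : ι → ℤ} {δ : K} (hδ : p.Lim δ 0)
    {N : ℤ} (hσ : ∏ i ∈ J, σ i ^ β i = δ ^ N) : ∏ i ∈ J, γ i ^ β i = 1 := by
  have hne : ∏ i ∈ J, γ i ^ β i ≠ 0 :=
    Finset.prod_ne_zero_iff.2 fun i hi => zpow_ne_zero _ (hγ i hi)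
  have h1 := Place.Lim.prod J fun i hi => (h i hi).zpow (hγ i hi) (β i)
  rw [hσ] at h1
  rcases lt_trichotomy N 0 with hN | hN | hN
  · exfalso
    have h2 := h1.inv hne
    obtain ⟨m, hm⟩ := Int.exists_eq_neg_ofNat hN.le
    rw [← zpow_neg, hm, neg_neg, zpow_natCast] at h2
    have h3 := hδ.pow m
    rw [zero_pow (by omega)] at h3
    exact inv_ne_zero hne (h2.unique h3)
  · rw [hN, zpow_zero] at h1
    exact h1.unique (Place.lim_one p)
  · exfalso
    obtain ⟨m, rfl⟩ := Int.eq_ofNat_of_zero_le hN.le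
    rw [zpow_natCast] at h1
    have h3 := hδ.pow m
    rw [zero_pow (by omega)] at h3
    exact hne (h1.unique h3)

/-- The exponents of the monomial `c χᵢ(t) u ^ mᵢ` in the variables `c`, `u`, `t`. -/
def exponents (χ : Fin s → Fin k → ℤ) (m : Fin s → ℤ) (i : Fin s) : Option (Option (Fin k)) → ℤ
  | none => 1
  | some none => m i
  | some (some j) => χ i j

/-- The point `(c, u, t)` of a torus. -/
def torusPoint {G : Type*} (c u : G) (t : Fin k → G) : Option (Option (Fin k)) → G
  | none => c
  | some none => u
  | some (some j) => t j

theorem prod_torusPoint {G : Type*} [CommGroup G] (c u : G) (t : Fin k → G) (m : Fin s → ℤ)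
    (i : Fin s) : ∏ l, torusPoint c u t l ^ exponents χ m i l =
      c * (∏ j, t j ^ χ i j) * u ^ m i := by
  rw [Fintype.prod_option, Fintype.prod_option]
  simp only [torusPoint, exponents, zpow_one]
  rw [mul_comm (u ^ m i), mul_assoc]

/-- The limit of the values of the weights `c χᵢ(t) κ ^ nᵢ` at a place where `κ` is infinite is
supported on an admissible face of maximal dimension: the exponents `-v(c)`, `-v(t)`, `-v(κ)` for
the valuation `v` of the place play the role of the vector `R`. -/
theorem exists_isMaxAdmissible_of_lim (v : Mod χ n) (hv : v ≠ 0) (c κ : Kˣ) (t : Fin k → Kˣ)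
    (hκ : p.Lim (κ⁻¹ : Kˣ) 0) (γ : Fin s → ℂ)
    (hγ : ∀ i, comp v i ≠ 0 → p.Lim ((c * (∏ j, t j ^ χ i j) * κ ^ (n i : ℤ) : Kˣ) : K) (γ i)) :
    ∃ F, IsMaxAdmissible (polyhedron v) F ∧ ∀ i, comp v i ≠ 0 → γ i ≠ 0 → charPoint χ n i ∈ F := by
  let V := p.valuationSubring
  let val : Kˣ →* V.ValueGroupˣ := Units.map V.valuation
  have hval : ∀ x : Kˣ, Additive.ofMul (val x) ≤ 0 ↔ ∃ a, p.Lim (x : K) a := by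
    intro x
    change val x ≤ 1 ↔ _
    rw [← Units.val_le_val, Units.val_one]
    exact V.valuation_le_one_iff x
  have hsum : ∀ i, ∑ l, augChar χ i l • (l.elim (Additive.ofMul (val c))
      fun j => Additive.ofMul (val (t j))) + (n i : ℤ) • Additive.ofMul (val κ) =
      Additive.ofMul (val (c * (∏ j, t j ^ χ i j) * κ ^ (n i : ℤ))) := by
    intro i
    rw [Fintype.sum_option]
    simp only [augChar, Option.elim, one_smul, map_mul, map_prod, map_zpow, ofMul_mul, ofMul_prod,
      ofMul_zpow]
  have hpos : 0 < Additive.ofMul (val κ) := by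
    rw [← not_le, hval]
    rintro ⟨a, ha⟩
    rw [Units.val_inv_eq_inv_val] at hκ
    exact Place.not_lim_of_inv κ.ne_zero hκ ha
  obtain ⟨F, hF, hFmem⟩ := exists_isMaxAdmissible_of_le v hv
    (fun l => l.elim (Additive.ofMul (val c)) fun j => Additive.ofMul (val (t j)))
    (Additive.ofMul (val κ)) hpos fun i hi => by
      rw [hsum, hval]
      exact ⟨_, hγ i hi⟩
  refine ⟨F, hF, fun i hi hγi => hFmem i hi ?_⟩
  rw [hsum]
  refine le_antisymm ((hval _).2 ⟨_, hγ i hi⟩) (neg_nonpos.1 ?_)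
  rw [← ofMul_inv, ← map_inv, hval, Units.val_inv_eq_inv_val]
  exact ⟨_, (hγ i hi).inv hγi⟩

end Limits

/-! ### Representatives of the orbits -/

/-- The vector with the components of `q` at the indices in `J`, and zeros elsewhere. -/
noncomputable def restrict (q : Mod χ n) (J : Finset (Fin s)) : Mod χ n :=
  ofComp (fun i => if i ∈ J then comp q i else 0) fun i => by
    split_ifs
    · exact comp_isHomogeneous q i
    · exact isHomogeneous_zero _ _ _

/-- If the components of `q` are weight vectors of weights `m i` of a one-parameter subgroup of
`SL₂`, then the vector with components `γ i * comp q i` is in the orbit of a restriction of `q`, as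
soon as the coefficients satisfy the relations among the weights. -/
theorem mem_orbit_restrict (q : Mod χ n) (m : Fin s → ℤ)
    (hq : ∀ u : ℂˣ, ∃ g : Matrix.SpecialLinearGroup (Fin 2) ℂ, ∀ i,
      subst g.1 (comp q i) = C ((u ^ m i : ℂˣ) : ℂ) * comp q i)
    (w : Mod χ n) (hw : w ≠ 0) (γ : Fin s → ℂ) (hwγ : ∀ i, comp w i = C (γ i) * comp q i)
    (hrel : ∀ (J : Finset (Fin s)) (β : Fin s → ℤ), (∀ i ∈ J, γ i ≠ 0) →
      (∀ l, ∑ i ∈ J, β i * exponents χ m i l = 0) → ∏ i ∈ J, γ i ^ β i = 1) :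
    ∃ (J : Finset (Fin s)) (hne : restrict q J ≠ 0), Projectivization.mk ℂ w hw ∈
      MulAction.orbit (Grp k) (Projectivization.mk ℂ _ hne) := by
  classical
  obtain ⟨J, hJ⟩ : ∃ J : Finset (Fin s), ∀ i, i ∈ J ↔ comp q i ≠ 0 ∧ γ i ≠ 0 :=
    ⟨Finset.univ.filter fun i => comp q i ≠ 0 ∧ γ i ≠ 0, fun i => by simp⟩
  let γ' : Fin s → ℂˣ := fun i => if h : γ i ≠ 0 then Units.mk0 (γ i) h else 1
  have hγ' : ∀ i ∈ J, (γ' i : ℂ) = γ i := fun i hi => by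
    simp only [γ', dif_pos ((hJ i).1 hi).2, Units.val_mk0]
  obtain ⟨τ, hτ⟩ := exists_torus_point J (exponents χ m) γ' fun β hβ => by
    refine Units.ext ?_
    rw [Units.coe_prod, Units.val_one, ← hrel J β (fun i hi => ((hJ i).1 hi).2) hβ]
    exact Finset.prod_congr rfl fun i hi => by rw [Units.val_zpow_eq_zpow_val, hγ' i hi]
  obtain ⟨g, hg⟩ := hq (τ (some none))
  have hτ' : τ = torusPoint (τ none) (τ (some none)) fun j => τ (some (some j)) := by
    ext l
    rcases l with _ | _ | j <;> rfl
  have key : w = (τ none : ℂ) • ((fun j => τ (some (some j)), g) : Grp k) • restrict q J := by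
    refine ext_comp fun i => ?_
    rw [hwγ, comp_smul, comp_grp_smul, restrict, comp_ofComp]
    split_ifs with hi
    · have h1 := hτ i hi
      rw [hτ', prod_torusPoint] at h1
      rw [← hγ' i hi, h1, hg, smul_eq_C_mul, smul_eq_C_mul, charVal]
      push_cast
      simp only [map_mul]
      ring
    · rw [map_zero, smul_zero, smul_zero]
      by_cases hqi : comp q i = 0
      · rw [hqi, mul_zero]
      · have : γ i = 0 := by
          by_contra h
          exact hi ((hJ i).2 ⟨hqi, h⟩)
        rw [this, C_0, zero_mul]
  have hne : restrict q J ≠ 0 := fun h => hw (by rw [key, h, smul_zero, smul_zero])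
  refine ⟨J, hne, ((fun j => τ (some (some j)), g) : Grp k), ?_⟩
  simp only [Projectivization.smul_mk]
  rw [Projectivization.mk_eq_mk_iff]
  refine ⟨(τ none)⁻¹, ?_⟩
  rw [key, Units.smul_def, smul_smul, Units.inv_mul, one_smul]

/-- The restriction of a form to the line `y = 0`. -/
noncomputable def onLine (u : MvPolynomial (Fin 2) ℂ) : MvPolynomial (Fin 2) ℂ :=
  subst !![1, 0; 0, 0] u

theorem subst_diagSL_onLine (c : ℂˣ) {u : MvPolynomial (Fin 2) ℂ} {m : ℕ} (hu : u.IsHomogeneous m) :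
    subst (diagSL c).1 (onLine u) = C ((c : ℂ) ^ m) * onLine u := by
  have hmat : (diagSL c).1 * !![1, 0; 0, 0] = (c : ℂ) • !![1, 0; 0, 0] := by
    ext i j
    fin_cases i <;> fin_cases j <;> simp [diagSL, Matrix.mul_apply, Fin.sum_univ_two]
  rw [onLine, ← AlgHom.comp_apply, ← subst_mul, hmat, ← substR_eq_subst, ← substR_eq_subst,
    substR_smul _ _ hu]

theorem subst_diagSL_X_zero (c : ℂˣ) : subst (diagSL c).1 (X 0) = C (c : ℂ) * X 0 := by
  rw [← substR_eq_subst, substR_X]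
  simp [diagSL]

theorem subst_diagSL_X_one (c : ℂˣ) : subst (diagSL c).1 (X 1) = C ((c⁻¹ : ℂˣ) : ℂ) * X 1 := by
  rw [← substR_eq_subst, substR_X]
  simp [diagSL]

theorem mul_onLine_isHomogeneous {u : MvPolynomial (Fin 2) ℂ} {m e : ℕ} (he : e ≤ m)
    (hu : u.IsHomogeneous (m - e)) (b : Fin 2) : (X b ^ e * onLine u).IsHomogeneous m := by
  have h1 : ((X b : MvPolynomial (Fin 2) ℂ) ^ e).IsHomogeneous e := isHomogeneous_X_pow b e
  have := h1.mul (subst_isHomogeneous !![1, 0; 0, 0] hu)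
  rwa [Nat.add_sub_cancel' he] at this

theorem onLine_subst_unip (v : Mod χ n) (i : Fin s) (z : ℂ) :
    onLine (subst (unip z).1 (comp v i)) = C ((dehom (comp v i)).eval z) * X 0 ^ n i := by
  have hmat : !![1, 0; 0, 0] * (unip z).1 = Matrix.of ![![1, z], 0] := by
    ext a b
    fin_cases a <;> fin_cases b <;> simp [unip, Matrix.mul_apply]
  rw [onLine, ← AlgHom.comp_apply, ← subst_mul, hmat, ← substR_eq_subst,
    substR_row _ (comp_isHomogeneous v i), ← eval_dehom]

section Degeneration

variable {K : Type*} [Field K] [Algebra ℂ K] {p : Place K}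

/-- Degeneration of `y ^ e u` under `x ↦ κ x`, `y ↦ κ⁻¹ y`. -/
theorem exists_lim_diag {F u : MvPolynomial (Fin 2) ℂ} {m e : ℕ} (hF : F = X 1 ^ e * u)
    (hFm : F.IsHomogeneous m) (hu : onLine u ≠ 0) {σ : K} {κ : Kˣ}
    (hκ : p.Lim (κ⁻¹ : Kˣ) 0) {Q : MvPolynomial (Fin 2) ℂ}
    (h : p.LimPoly (C σ * substR !![(κ : K), 0; 0, (κ : K)⁻¹]
      (MvPolynomial.map (algebraMap ℂ K) F)) Q) :
    ∃ γ, p.Lim (σ * (κ : K) ^ ((m : ℤ) - 2 * e)) γ ∧ Q = C γ * (X 1 ^ e * onLine u) := by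
  have hmat : !![(κ : K), 0; 0, (κ : K)⁻¹] = (κ : K) • !![1, 0; 0, (κ : K)⁻¹ ^ 2] := by
    ext i j
    fin_cases i <;> fin_cases j <;> simp [pow_two]
  have hFm' : (MvPolynomial.map (algebraMap ℂ K) F).IsHomogeneous m := hFm.map _
  have hFK : MvPolynomial.map (algebraMap ℂ K) F =
      X 1 ^ e * MvPolynomial.map (algebraMap ℂ K) u := by
    rw [hF, map_mul, map_pow, map_X]
  have hpow : (κ : K) ^ m * ((κ : K)⁻¹ ^ 2) ^ e = (κ : K) ^ ((m : ℤ) - 2 * e) := by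
    rw [← pow_mul, inv_pow, zpow_sub₀ κ.ne_zero, zpow_natCast, div_eq_mul_inv]
    congr 2
    exact_mod_cast (zpow_natCast (κ : K) (2 * e)).symm
  have heq : C σ * substR !![(κ : K), 0; 0, (κ : K)⁻¹] (MvPolynomial.map (algebraMap ℂ K) F) =
      C (σ * (κ : K) ^ ((m : ℤ) - 2 * e)) * (X 1 ^ e * substR !![1, 0; 0, (κ : K)⁻¹ ^ 2]
        (MvPolynomial.map (algebraMap ℂ K) u)) := by
    have hX1 : substR !![1, 0; 0, (κ : K)⁻¹ ^ 2] (X 1) = C ((κ : K)⁻¹ ^ 2) * X 1 := by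
      rw [substR_X]
      simp
    rw [hmat, substR_smul _ _ hFm', hFK, map_mul, map_pow (substR _), hX1, mul_pow, ← hpow]
    simp only [C_mul, C_pow]
    ring
  rw [heq] at h
  refine h.exists_of_C_mul (((Place.limPoly_X p 1).pow e).mul
    (limPoly_substR (fun i j => ?_) (Place.limPoly_map p u)))
      (mul_ne_zero (pow_ne_zero _ (X_ne_zero 1)) hu)
  have hκ2 := hκ.pow 2
  rw [Units.val_inv_eq_inv_val, zero_pow two_ne_zero] at hκ2
  fin_cases i <;> fin_cases j
  · exact Place.lim_one p
  · exact Place.lim_zero p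
  · exact Place.lim_zero p
  · exact hκ2

/-- Degeneration of `y ^ e u` under `x ↦ κ x`, `y ↦ κ ε x + κ⁻¹ y`, where the first term
dominates. -/
theorem exists_lim_unip {F u : MvPolynomial (Fin 2) ℂ} {m e : ℕ} (hF : F = X 1 ^ e * u)
    (hFm : F.IsHomogeneous m) (hu : onLine u ≠ 0) {σ : K} {κ ε : Kˣ}
    (hκ : p.Lim (κ⁻¹ : Kˣ) 0) (hε : p.Lim ε 0) (hκε : p.Lim ((κ : K) ^ 2 * ε)⁻¹ 0)
    {Q : MvPolynomial (Fin 2) ℂ}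
    (h : p.LimPoly (C σ * substR !![(κ : K), κ * ε; 0, (κ : K)⁻¹]
      (MvPolynomial.map (algebraMap ℂ K) F)) Q) :
    ∃ γ, p.Lim (σ * (κ : K) ^ m * (ε : K) ^ e) γ ∧ Q = C γ * (X 0 ^ e * onLine u) := by
  have hmat : !![(κ : K), κ * ε; 0, (κ : K)⁻¹] = (κ : K) • !![1, (ε : K); 0, (κ : K)⁻¹ ^ 2] := by
    ext i j
    fin_cases i <;> fin_cases j <;> simp [pow_two]
  have hFm' : (MvPolynomial.map (algebraMap ℂ K) F).IsHomogeneous m := hFm.map _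
  have hFK : MvPolynomial.map (algebraMap ℂ K) F =
      X 1 ^ e * MvPolynomial.map (algebraMap ℂ K) u := by
    rw [hF, map_mul, map_pow, map_X]
  have hX : (C (ε : K) * X 0 + C ((κ : K)⁻¹ ^ 2) * X 1 : MvPolynomial (Fin 2) K) =
      C (ε : K) * (X 0 + C ((κ : K) ^ 2 * ε)⁻¹ * X 1) := by
    rw [mul_add, ← mul_assoc (C (ε : K)), ← C_mul]
    congr 3
    have := ε.ne_zero
    field_simp
  have heq : C σ * substR !![(κ : K), κ * ε; 0, (κ : K)⁻¹] (MvPolynomial.map (algebraMap ℂ K) F) =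
      C (σ * (κ : K) ^ m * (ε : K) ^ e) * ((X 0 + C ((κ : K) ^ 2 * ε)⁻¹ * X 1) ^ e *
        substR !![1, (ε : K); 0, (κ : K)⁻¹ ^ 2] (MvPolynomial.map (algebraMap ℂ K) u)) := by
    have hX1 : substR !![1, (ε : K); 0, (κ : K)⁻¹ ^ 2] (X 1) =
        C (ε : K) * (X 0 + C ((κ : K) ^ 2 * ε)⁻¹ * X 1) := by
      rw [← hX, substR_X]
      rfl
    rw [hmat, substR_smul _ _ hFm', hFK, map_mul, map_pow (substR _), hX1, mul_pow]
    simp only [C_mul, C_pow]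
    ring
  rw [heq] at h
  have hκ2 := hκ.pow 2
  rw [Units.val_inv_eq_inv_val, zero_pow two_ne_zero] at hκ2
  have hX0 : p.LimPoly (X 0 + C ((κ : K) ^ 2 * ε)⁻¹ * X 1) (X 0) := by
    have := (Place.limPoly_X p 0).add ((Place.limPoly_C hκε).mul (Place.limPoly_X p 1))
    rwa [C_0, zero_mul, add_zero] at this
  refine h.exists_of_C_mul ((hX0.pow e).mul
    (limPoly_substR (fun i j => ?_) (Place.limPoly_map p u)))
      (mul_ne_zero (pow_ne_zero _ (X_ne_zero 0)) hu)
  fin_cases i <;> fin_cases j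
  · exact Place.lim_one p
  · exact hε
  · exact Place.lim_zero p
  · exact hκ2

end Degeneration

/-! ### Finiteness of the set of orbits -/

/-- After the point `o` of the projective line has been moved to `(1 : 0)`, split off the powers of `y`
from the components. -/
theorem exists_eq_X_one_pow_mul_comp (v : Mod χ n) (o : Option ℂ) (i : Fin s) :
    ∃ x : ℕ × MvPolynomial (Fin 2) ℂ, x.1 ≤ n i ∧
      subst (dirMat o).1 (comp v i) = X 1 ^ x.1 * x.2 ∧ x.2.IsHomogeneous (n i - x.1) ∧
      (comp v i ≠ 0 → onLine x.2 ≠ 0) := by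
  by_cases h : comp v i = 0
  · exact ⟨(0, 0), Nat.zero_le _, by rw [h, map_zero, mul_zero], isHomogeneous_zero _ _ _,
      fun h' => absurd h h'⟩
  · have h' : subst (dirMat o).1 (comp v i) ≠ 0 := by
      intro h0
      refine h ?_
      have h1 := congrArg (subst (dirMat o)⁻¹.1) h0
      rw [← AlgHom.comp_apply, ← subst_mul, ← Matrix.SpecialLinearGroup.coe_mul, inv_mul_cancel,
        Matrix.SpecialLinearGroup.coe_one, subst_one, map_zero] at h1
      exact h1
    obtain ⟨e, u, he, hF, hu, hu'⟩ := exists_eq_X_one_pow_mul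
      (subst_isHomogeneous (dirMat o).1 (comp_isHomogeneous v i)) h'
    exact ⟨(e, u), he, hF, hu, fun _ => hu'⟩

/-- The multiplicity of the point `o` of the projective line as a zero of the `i`-th component, if
this component is nonzero. -/
noncomputable def dirMult (v : Mod χ n) (o : Option ℂ) (i : Fin s) : ℕ :=
  (exists_eq_X_one_pow_mul_comp v o i).choose.1

/-- The cofactor of `y ^ dirMult v o i` in the moved `i`-th component. -/
noncomputable def dirCofactor (v : Mod χ n) (o : Option ℂ) (i : Fin s) : MvPolynomial (Fin 2) ℂ :=
  (exists_eq_X_one_pow_mul_comp v o i).choose.2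

section Direction

variable (v : Mod χ n) (o : Option ℂ) (i : Fin s)

theorem dirMult_le : dirMult v o i ≤ n i := (exists_eq_X_one_pow_mul_comp v o i).choose_spec.1

theorem subst_dirMat_comp :
    subst (dirMat o).1 (comp v i) = X 1 ^ dirMult v o i * dirCofactor v o i :=
  (exists_eq_X_one_pow_mul_comp v o i).choose_spec.2.1

theorem dirCofactor_isHomogeneous : (dirCofactor v o i).IsHomogeneous (n i - dirMult v o i) :=
  (exists_eq_X_one_pow_mul_comp v o i).choose_spec.2.2.1

theorem onLine_dirCofactor_ne_zero (hi : comp v i ≠ 0) : onLine (dirCofactor v o i) ≠ 0 :=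
  (exists_eq_X_one_pow_mul_comp v o i).choose_spec.2.2.2 hi

theorem subst_dirMat_isHomogeneous :
    (subst (dirMat o).1 (comp v i)).IsHomogeneous (n i) :=
  subst_isHomogeneous _ (comp_isHomogeneous v i)

/-- With `b = 1`, the leading terms of the moved components under `x ↦ κ x`, `y ↦ κ⁻¹ y` for large
`κ`; with `b = 0`, those under `x ↦ κ x`, `y ↦ κ ε x + κ⁻¹ y` for large `κ` and `κ² ε`, and small
`ε`. -/
noncomputable def leading (b : Fin 2) : Mod χ n :=
  ofComp (fun i => X b ^ dirMult v o i * onLine (dirCofactor v o i)) fun i =>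
    mul_onLine_isHomogeneous (dirMult_le v o i) (dirCofactor_isHomogeneous v o i) b

theorem comp_leading (b : Fin 2) :
    comp (leading v o b) i = X b ^ dirMult v o i * onLine (dirCofactor v o i) := rfl

theorem subst_diagSL_leading_zero (c : ℂˣ) : subst (diagSL c).1 (comp (leading v o 0) i) =
    C ((c ^ (n i : ℤ) : ℂˣ) : ℂ) * comp (leading v o 0) i := by
  rw [comp_leading, map_mul, map_pow, subst_diagSL_X_zero,
    subst_diagSL_onLine c (dirCofactor_isHomogeneous v o i), mul_pow, ← C_pow, mul_mul_mul_comm,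
    ← C_mul, ← pow_add, Nat.add_sub_cancel' (dirMult_le v o i), zpow_natCast,
    Units.val_pow_eq_pow_val]

theorem subst_diagSL_leading_one (c : ℂˣ) : subst (diagSL c).1 (comp (leading v o 1) i) =
    C ((c ^ ((n i : ℤ) - 2 * dirMult v o i) : ℂˣ) : ℂ) * comp (leading v o 1) i := by
  have hpow : c ^ ((n i : ℤ) - 2 * dirMult v o i) =
      c⁻¹ ^ dirMult v o i * c ^ (n i - dirMult v o i) := by
    rw [← zpow_natCast, ← zpow_natCast, inv_zpow', ← zpow_add, Nat.cast_sub (dirMult_le v o i)]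
    congr 1
    ring
  rw [comp_leading, map_mul, map_pow, subst_diagSL_X_one,
    subst_diagSL_onLine c (dirCofactor_isHomogeneous v o i), mul_pow, ← C_pow, mul_mul_mul_comm,
    ← C_mul, hpow, Units.val_mul, Units.val_pow_eq_pow_val, Units.val_pow_eq_pow_val]

end Direction

/-- Relations among weights are relations among the values of the corresponding monomials. -/
theorem prod_torusPoint_zpow {K : Type*} [Field K] (c κ : Kˣ) (t : Fin k → Kˣ) (m : Fin s → ℤ)
    (J : Finset (Fin s)) {β : Fin s → ℤ} (hβ : ∀ l, ∑ i ∈ J, β i * exponents χ m i l = 0) :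
    ∏ i ∈ J, (((c * ∏ j, t j ^ χ i j : Kˣ) : K) * (κ : K) ^ m i) ^ β i = 1 := by
  have h1 := congrArg Units.val
    (prod_monomial_zpow_eq_one J (torusPoint c κ t) (exponents χ m) β hβ)
  rw [Units.coe_prod, Units.val_one] at h1
  rw [← h1]
  refine Finset.prod_congr rfl fun i _ => ?_
  rw [prod_torusPoint, Units.val_zpow_eq_zpow_val, Units.val_mul (c * _),
    Units.val_zpow_eq_zpow_val κ]

section Limits

variable {K : Type*} [Field K] [Algebra ℂ K] {p : Place K}

/-- The points of the closure, up to the action of `SL₂(ℂ)`, only depend on the class of the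
matrix `g`. -/
theorem Reduces.exists_smul {g b : Matrix (Fin 2) (Fin 2) K} (hgb : Reduces p g b) {v w : Mod χ n}
    {σ : Fin s → K} (h : ∀ i, p.LimPoly
      (C (σ i) * substR g (MvPolynomial.map (algebraMap ℂ K) (comp v i))) (comp w i)) :
    ∃ γ : Grp k, ∀ i, p.LimPoly
      (C (σ i) * substR b (MvPolynomial.map (algebraMap ℂ K) (comp v i))) (comp (γ • w) i) := by
  obtain ⟨x, x₀, hx, rfl⟩ := hgb
  refine ⟨(1, x₀), fun i => ?_⟩
  have h1 := limPoly_substR hx (h i)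
  have h2 : comp ((((1 : Fin k → ℂˣ), x₀) : Grp k) • w) i = subst x₀.1 (comp w i) := by
    rw [comp_grp_smul]
    simp [charVal]
  rw [h2, substR_mul_apply]
  rwa [map_mul, substR, algHom_C, algebraMap_eq] at h1

theorem substR_mul_dirMat_map (b : Matrix (Fin 2) (Fin 2) K) (o : Option ℂ)
    (F : MvPolynomial (Fin 2) ℂ) :
    substR (b * (algebraMap ℂ K).mapMatrix (dirMat o).1) (MvPolynomial.map (algebraMap ℂ K) F) =
      substR b (MvPolynomial.map (algebraMap ℂ K) (subst (dirMat o).1 F)) := by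
  rw [substR_mul_apply, ← map_substR]
  rfl

/-- Points of the closure at places where the element of `SL₂` stays bounded. -/
theorem mem_orbit_of_reduces_one {v w : Mod χ n} (hw : w ≠ 0) {c : Kˣ} {t : Fin k → Kˣ}
    (h : ∀ i, p.LimPoly (C ((c * ∏ j, t j ^ χ i j : Kˣ) : K) *
      MvPolynomial.map (algebraMap ℂ K) (comp v i)) (comp w i)) :
    ∃ (J : Finset (Fin s)) (hne : restrict v J ≠ 0), Projectivization.mk ℂ w hw ∈
      MulAction.orbit (Grp k) (Projectivization.mk ℂ _ hne) := by
  classical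
  have hex : ∀ i, ∃ γ : ℂ, comp w i = C γ * comp v i ∧
      (γ ≠ 0 → p.Lim ((c * ∏ j, t j ^ χ i j : Kˣ) : K) γ) := by
    intro i
    by_cases hi : comp v i = 0
    · have h1 := h i
      rw [hi, map_zero, mul_zero, ← C_0] at h1
      refine ⟨0, ?_, fun h' => absurd rfl h'⟩
      rw [C_0, zero_mul]
      exact (h1.unique (Place.limPoly_C (Place.lim_zero p))).trans C_0
    · obtain ⟨γ, h1, h2⟩ := (h i).exists_of_C_mul (Place.limPoly_map p _) hi
      exact ⟨γ, h2, fun _ => h1⟩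
  choose γ hγ hlim using hex
  refine mem_orbit_restrict v (fun _ => 0) (fun u => ⟨1, fun i => ?_⟩) w hw γ hγ
    fun J β hJ hβ => ?_
  · rw [Matrix.SpecialLinearGroup.coe_one, subst_one, zpow_zero, Units.val_one, C_1, one_mul]
    rfl
  · refine prod_zpow_eq_one_of_lim (p := p) (fun i hi => hlim i (hJ i hi)) hJ ?_
    have h1 := prod_torusPoint_zpow c 1 t (fun _ => 0) _ hβ
    simpa using h1

/-- Points of the closure at places of the first kind of normal form. -/
theorem mem_orbit_of_diag {v w : Mod χ n} (hw : w ≠ 0) {c κ : Kˣ} {t : Fin k → Kˣ}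
    (hκ : p.Lim (κ⁻¹ : Kˣ) 0) (o : Option ℂ)
    (h : ∀ i, p.LimPoly (C ((c * ∏ j, t j ^ χ i j : Kˣ) : K) *
      substR !![(κ : K), 0; 0, (κ : K)⁻¹] (MvPolynomial.map (algebraMap ℂ K)
        (subst (dirMat o).1 (comp v i)))) (comp w i)) :
    ∃ (J : Finset (Fin s)) (hne : restrict (leading v o 1) J ≠ 0), Projectivization.mk ℂ w hw ∈
      MulAction.orbit (Grp k) (Projectivization.mk ℂ _ hne) := by
  classical
  have hex : ∀ i, ∃ γ : ℂ, comp w i = C γ * comp (leading v o 1) i ∧ (γ ≠ 0 →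
      p.Lim (((c * ∏ j, t j ^ χ i j : Kˣ) : K) * (κ : K) ^ ((n i : ℤ) - 2 * dirMult v o i)) γ) := by
    intro i
    by_cases hi : comp v i = 0
    · have h1 := h i
      rw [hi, map_zero, map_zero, map_zero, mul_zero, ← C_0] at h1
      refine ⟨0, ?_, fun h' => absurd rfl h'⟩
      rw [C_0, zero_mul]
      exact (h1.unique (Place.limPoly_C (Place.lim_zero p))).trans C_0
    · obtain ⟨γ, h1, h2⟩ := exists_lim_diag (subst_dirMat_comp v o i)
        (subst_dirMat_isHomogeneous v o i) (onLine_dirCofactor_ne_zero v o i hi) hκ (h i)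
      exact ⟨γ, h2, fun _ => h1⟩
  choose γ hγ hlim using hex
  exact mem_orbit_restrict _ _ (fun u => ⟨diagSL u, fun i => subst_diagSL_leading_one v o i u⟩)
    w hw γ hγ fun J β hJ hβ => prod_zpow_eq_one_of_lim (p := p) (fun i hi => hlim i (hJ i hi)) hJ
      (prod_torusPoint_zpow c κ t _ _ hβ)

/-- Points of the closure at places of the second kind of normal form. The relations among the
weights hold for the coefficients up to powers of the infinitesimal `ε`, which have to be trivial
as the coefficients are finite and nonzero. -/
theorem mem_orbit_of_unip {v w : Mod χ n} (hw : w ≠ 0) {c κ ε : Kˣ} {t : Fin k → Kˣ}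
    (hκ : p.Lim (κ⁻¹ : Kˣ) 0) (hε : p.Lim ε 0) (hκε : p.Lim ((κ : K) ^ 2 * ε)⁻¹ 0) (o : Option ℂ)
    (h : ∀ i, p.LimPoly (C ((c * ∏ j, t j ^ χ i j : Kˣ) : K) *
      substR !![(κ : K), κ * ε; 0, (κ : K)⁻¹] (MvPolynomial.map (algebraMap ℂ K)
        (subst (dirMat o).1 (comp v i)))) (comp w i)) :
    ∃ (J : Finset (Fin s)) (hne : restrict (leading v o 0) J ≠ 0), Projectivization.mk ℂ w hw ∈
      MulAction.orbit (Grp k) (Projectivization.mk ℂ _ hne) := by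
  classical
  have hex : ∀ i, ∃ γ : ℂ, comp w i = C γ * comp (leading v o 0) i ∧ (γ ≠ 0 →
      p.Lim (((c * ∏ j, t j ^ χ i j : Kˣ) : K) * (κ : K) ^ n i * (ε : K) ^ dirMult v o i) γ) := by
    intro i
    by_cases hi : comp v i = 0
    · have h1 := h i
      rw [hi, map_zero, map_zero, map_zero, mul_zero, ← C_0] at h1
      refine ⟨0, ?_, fun h' => absurd rfl h'⟩
      rw [C_0, zero_mul]
      exact (h1.unique (Place.limPoly_C (Place.lim_zero p))).trans C_0
    · obtain ⟨γ, h1, h2⟩ := exists_lim_unip (subst_dirMat_comp v o i)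
        (subst_dirMat_isHomogeneous v o i) (onLine_dirCofactor_ne_zero v o i hi) hκ hε hκε (h i)
      exact ⟨γ, h2, fun _ => h1⟩
  choose γ hγ hlim using hex
  refine mem_orbit_restrict _ (fun i => (n i : ℤ))
    (fun u => ⟨diagSL u, fun i => subst_diagSL_leading_zero v o i u⟩) w hw γ hγ
    fun J β hJ hβ => prod_zpow_eq_one_of_lim_of_zpow (p := p) (fun i hi => hlim i (hJ i hi)) hJ hε
      (N := ∑ i ∈ J, (dirMult v o i : ℤ) * β i) ?_
  have h1 := prod_torusPoint_zpow c κ t _ _ hβ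
  have h2 := congrArg Units.val (prod_zpow_const J ε fun i => (dirMult v o i : ℤ) * β i)
  rw [Units.coe_prod, Units.val_zpow_eq_zpow_val] at h2
  have h3 := congrArg₂ (· * ·) h1 h2
  simp only [one_mul, ← Finset.prod_mul_distrib] at h3
  rw [← h3]
  refine Finset.prod_congr rfl fun i _ => ?_
  rw [mul_zpow _ ((ε : K) ^ _), Units.val_zpow_eq_zpow_val, zpow_mul, zpow_natCast, zpow_natCast]

/-- A direction that is not a zero of any component gives the same orbits as any other such
direction `a`: on maximal admissible faces, the vectors `(v i (1, z))` for these `z` satisfy the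
same relations. -/
theorem mem_orbit_of_generic {v w : Mod χ n} (hv : v ≠ 0) (hw : w ≠ 0)
    (hcond : ∀ F, IsMaxAdmissible (polyhedron v) F → ∀ β : Fin s → ℤ,
      (∑ i ∈ faceIndices v F, β i • χ i = 0) → (∑ i ∈ faceIndices v F, β i = 0) →
        ∀ a : ℂ, ∑ i ∈ faceIndices v F, (mult v i a : ℤ) * β i = 0)
    {a z : ℂ} (ha : ∀ i, comp v i ≠ 0 → (dehom (comp v i)).eval a ≠ 0)
    (hz : ∀ i, comp v i ≠ 0 → (dehom (comp v i)).eval z ≠ 0) {c κ : Kˣ} {t : Fin k → Kˣ}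
    (hκ : p.Lim (κ⁻¹ : Kˣ) 0)
    (h : ∀ i, comp v i ≠ 0 → ∃ γ, p.Lim (((c * ∏ j, t j ^ χ i j : Kˣ) : K) * (κ : K) ^ n i) γ ∧
      comp w i = C γ * onLine (subst (unip z).1 (comp v i)))
    (h0 : ∀ i, comp v i = 0 → comp w i = 0) :
    ∃ (J : Finset (Fin s)) (hne : restrict (faceLimit v Finset.univ a) J ≠ 0),
      Projectivization.mk ℂ w hw ∈
        MulAction.orbit (Grp k) (Projectivization.mk ℂ _ hne) := by
  classical
  have hex : ∀ i, ∃ γ : ℂ, (comp v i = 0 → γ = 0) ∧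
      comp w i = C (γ * (dehom (comp v i)).eval z) * X 0 ^ n i ∧ (comp v i ≠ 0 →
        p.Lim (((c * ∏ j, t j ^ χ i j : Kˣ) : K) * (κ : K) ^ n i) γ) := by
    intro i
    by_cases hi : comp v i = 0
    · exact ⟨0, fun _ => rfl, by rw [h0 i hi, zero_mul, C_0, zero_mul], fun h' => absurd hi h'⟩
    · obtain ⟨γ, h1, h2⟩ := h i hi
      refine ⟨γ, fun h' => absurd h' hi, ?_, fun _ => h1⟩
      rw [h2, onLine_subst_unip, C_mul, mul_assoc]
  choose γ hγ0 hγ hlim using hex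
  obtain ⟨F, hF, hFmem⟩ := exists_isMaxAdmissible_of_lim v hv c κ t hκ γ fun i hi => by
    have := hlim i hi
    rwa [Units.val_mul (c * _), Units.val_zpow_eq_zpow_val κ, zpow_natCast]
  let ratio : Fin s → ℂ := fun i => (dehom (comp v i)).eval z / (dehom (comp v i)).eval a
  have hcomp : ∀ i, comp (faceLimit v Finset.univ a) i =
      C ((dehom (comp v i)).eval a) * X 0 ^ n i := fun i => comp_faceLimit v a (Finset.mem_univ i)
  have hvJ : ∀ i, γ i * ratio i ≠ 0 → comp v i ≠ 0 ∧ γ i ≠ 0 := fun i hi =>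
    ⟨fun h' => left_ne_zero_of_mul hi (hγ0 i h'), left_ne_zero_of_mul hi⟩
  refine mem_orbit_restrict _ (fun i => (n i : ℤ)) (fun u => ⟨diagSL u, fun i => ?_⟩)
    w hw (fun i => γ i * ratio i) (fun i => ?_) fun J β hJ hβ => ?_
  · rw [hcomp, map_mul, map_pow, subst_diagSL_X_zero, subst, algHom_C, algebraMap_eq, mul_pow,
      ← C_pow, zpow_natCast, Units.val_pow_eq_pow_val, mul_left_comm]
  · rw [hγ, hcomp, ← mul_assoc, ← C_mul]
    by_cases hi : comp v i = 0
    · rw [hγ0 i hi]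
      simp
    · rw [mul_assoc, div_mul_cancel₀ _ (ha i hi)]
  · have hJv : ∀ i ∈ J, comp v i ≠ 0 ∧ γ i ≠ 0 := fun i hi => hvJ i (hJ i hi)
    have hJF : J ⊆ faceIndices v F := fun i hi => by
      simp only [faceIndices, Finset.mem_filter, Finset.mem_univ, true_and]
      exact ⟨(hJv i hi).1, hFmem i (hJv i hi).1 (hJv i hi).2⟩
    have hγ1 : ∏ i ∈ J, γ i ^ β i = 1 := by
      refine prod_zpow_eq_one_of_lim (p := p) (fun i hi => hlim i (hJv i hi).1)
        (fun i hi => (hJv i hi).2) ?_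
      simpa only [zpow_natCast] using prod_torusPoint_zpow c κ t _ J hβ
    -- the relation `β`, extended by zero to the indices of the face
    have hsum : ∀ {M : Type} [AddCommGroup M] (x : Fin s → M),
        ∑ i ∈ faceIndices v F, (if i ∈ J then β i else 0) • x i = ∑ i ∈ J, β i • x i := by
      intro M _ x
      rw [← Finset.sum_subset hJF fun i _ hi => by rw [if_neg hi, zero_smul]]
      exact Finset.sum_congr rfl fun i hi => by rw [if_pos hi]
    have hmult : ∀ r, ∑ i ∈ J, ((dehom (comp v i)).rootMultiplicity r : ℤ) * β i = 0 := by
      intro r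
      have h1 := hcond F hF (fun i => if i ∈ J then β i else 0) ?_ ?_ (-r)
      · have h2 := hsum fun i => (mult v i (-r) : ℤ)
        simp only [smul_eq_mul] at h2
        rw [Finset.sum_congr rfl fun i _ => mul_comm _ _, h2] at h1
        rw [← h1]
        refine Finset.sum_congr rfl fun i hi => ?_
        rw [mult_eq_rootMultiplicity v (hJv i hi).1, neg_neg, mul_comm]
      · rw [hsum]
        ext j
        rw [Finset.sum_apply]
        exact hβ (some (some j))
      · have h2 := hsum fun _ => (1 : ℤ)
        simp only [smul_eq_mul, mul_one] at h2
        rw [h2]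
        simpa [exponents] using hβ none
    have hr := prod_zpow_eval_eq_of_sum_eq_zero J (fun i => dehom (comp v i))
      (fun i hi => dehom_ne_zero (comp_isHomogeneous v i) (hJv i hi).1) β hmult
      (fun i hi => hz i (hJv i hi).1) (fun i hi => ha i (hJv i hi).1)
    have hne : ∏ i ∈ J, (dehom (comp v i)).eval a ^ β i ≠ 0 :=
      Finset.prod_ne_zero_iff.2 fun i hi => zpow_ne_zero _ (ha i (hJv i hi).1)
    simp only [ratio, mul_zpow, div_zpow, Finset.prod_mul_distrib, Finset.prod_div_distrib, hγ1,
      one_mul]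
    rw [hr, div_self hne]

end Limits

/-- The zeros of the nonzero components, and the point at infinity. -/
def specialDirs (v : Mod χ n) : Set (Option ℂ) :=
  insert none (some '' {z | ∃ i, comp v i ≠ 0 ∧ (dehom (comp v i)).eval z = 0})

theorem setOf_root_finite (v : Mod χ n) :
    {z : ℂ | ∃ i, comp v i ≠ 0 ∧ (dehom (comp v i)).eval z = 0}.Finite := by
  have : {z : ℂ | ∃ i, comp v i ≠ 0 ∧ (dehom (comp v i)).eval z = 0} ⊆
      ⋃ i, {z | z ∈ (dehom (comp v i)).roots} := by
    rintro z ⟨i, hi, hz⟩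
    exact Set.mem_iUnion.2 ⟨i, (Polynomial.mem_roots
      (dehom_ne_zero (comp_isHomogeneous v i) hi)).2 hz⟩
  exact (Set.finite_iUnion fun i => Multiset.finite_toSet _).subset this

/-- The orbits in the closure are those of the restrictions of finitely many vectors. -/
theorem exists_mem_orbit_restrict (v : Mod χ n) (hv : v ≠ 0)
    (hcond : ∀ F, IsMaxAdmissible (polyhedron v) F → ∀ β : Fin s → ℤ,
      (∑ i ∈ faceIndices v F, β i • χ i = 0) → (∑ i ∈ faceIndices v F, β i = 0) →
        ∀ a : ℂ, ∑ i ∈ faceIndices v F, (mult v i a : ℤ) * β i = 0)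
    {a : ℂ} (ha : ∀ i, comp v i ≠ 0 → (dehom (comp v i)).eval a ≠ 0)
    (w : Mod χ n) (hw : w ≠ 0) (h : Projectivization.mk ℂ w hw ∈ zariskiClosure
      (MulAction.orbit (Grp k) (Projectivization.mk ℂ v hv))) :
    ∃ q ∈ insert v (insert (faceLimit v Finset.univ a)
        (Set.image2 (leading v) (specialDirs v) Set.univ)),
      ∃ (J : Finset (Fin s)) (hne : restrict q J ≠ 0), Projectivization.mk ℂ w hw ∈
        MulAction.orbit (Grp k) (Projectivization.mk ℂ _ hne) := by
  obtain ⟨K, _, _, p, c, t, g, hg, hlim⟩ := exists_place v hv w hw h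
  -- it suffices to consider a translate of `w`
  have hmove : ∀ (γ : Grp k) (hγ : γ • w ≠ 0) {q : Mod χ n},
      (∃ (J : Finset (Fin s)) (hne : restrict q J ≠ 0), Projectivization.mk ℂ (γ • w) hγ ∈
        MulAction.orbit (Grp k) (Projectivization.mk ℂ _ hne)) →
      ∃ (J : Finset (Fin s)) (hne : restrict q J ≠ 0), Projectivization.mk ℂ w hw ∈
        MulAction.orbit (Grp k) (Projectivization.mk ℂ _ hne) := by
    rintro γ hγ q ⟨J, hne, hJ⟩
    refine ⟨J, hne, ?_⟩
    rw [← Projectivization.smul_mk (g := γ) (v := w) hw] at hJ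
    rwa [← MulAction.orbit_eq_iff, MulAction.orbit_smul, MulAction.orbit_eq_iff] at hJ
  have hmove0 : ∀ γ : Grp k, γ • w ≠ 0 := fun γ => (smul_ne_zero_iff_ne γ).2 hw
  rcases reduces_one_or_isNormal (p := p) hg with hred | ⟨o, κ, hκ0, hκ, hred⟩
  · obtain ⟨γ, hγ⟩ := hred.exists_smul hlim
    refine ⟨v, Or.inl rfl, hmove γ (hmove0 γ) (mem_orbit_of_reduces_one (hmove0 γ)
      (p := p) (c := c) (t := t) fun i => ?_)⟩
    have := hγ i
    rwa [substR_one] at this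
  · lift κ to Kˣ using hκ0.isUnit
    rw [← Units.val_inv_eq_inv_val] at hκ
    have hdata : ∃ (γ : Grp k), (∀ i, p.LimPoly (C ((c * ∏ j, t j ^ χ i j : Kˣ) : K) *
          substR !![(κ : K), 0; 0, (κ : K)⁻¹] (MvPolynomial.map (algebraMap ℂ K)
            (subst (dirMat o).1 (comp v i)))) (comp (γ • w) i)) ∨
        ∃ ε : Kˣ, p.Lim ε 0 ∧ p.Lim ((κ : K) ^ 2 * ε)⁻¹ 0 ∧
          ∀ i, p.LimPoly (C ((c * ∏ j, t j ^ χ i j : Kˣ) : K) *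
            substR !![(κ : K), κ * ε; 0, (κ : K)⁻¹] (MvPolynomial.map (algebraMap ℂ K)
              (subst (dirMat o).1 (comp v i)))) (comp (γ • w) i) := by
      rcases hred with hred | ⟨ε, hε0, hε, hκε, hred⟩
      · obtain ⟨γ, hγ⟩ := hred.exists_smul hlim
        exact ⟨γ, Or.inl fun i => by rw [← substR_mul_dirMat_map]; exact hγ i⟩
      · obtain ⟨γ, hγ⟩ := hred.exists_smul hlim
        exact ⟨γ, Or.inr ⟨Units.mk0 ε hε0, hε, hκε, fun i => by
          rw [← substR_mul_dirMat_map]; exact hγ i⟩⟩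
    obtain ⟨γ, hγ⟩ := hdata
    by_cases ho : o ∈ specialDirs v
    · rcases hγ with hγ | ⟨ε, hε, hκε, hγ⟩
      · exact ⟨leading v o 1, Or.inr (Or.inr ⟨o, ho, 1, trivial, rfl⟩),
          hmove γ (hmove0 γ) (mem_orbit_of_diag (hmove0 γ) hκ o hγ)⟩
      · exact ⟨leading v o 0, Or.inr (Or.inr ⟨o, ho, 0, trivial, rfl⟩),
          hmove γ (hmove0 γ) (mem_orbit_of_unip (hmove0 γ) hκ hε hκε o hγ)⟩
    · obtain ⟨z, rfl, hz⟩ : ∃ z, o = some z ∧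
          ∀ i, comp v i ≠ 0 → (dehom (comp v i)).eval z ≠ 0 := by
        rcases o with _ | z
        · exact absurd (Or.inl rfl) ho
        · exact ⟨z, rfl, fun i hi hz => ho (Or.inr ⟨z, ⟨i, hi, hz⟩, rfl⟩)⟩
      refine ⟨faceLimit v Finset.univ a, Or.inr (Or.inl rfl), hmove γ (hmove0 γ)
        (mem_orbit_of_generic hv (hmove0 γ) hcond ha hz (p := p) (c := c) (t := t) hκ
          (fun i hi => ?_) fun i hi => ?_)⟩
      · have hF : subst (dirMat (some z)).1 (comp v i) =
            X 1 ^ 0 * subst (unip z).1 (comp v i) := by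
          rw [pow_zero, one_mul]
          rfl
        have hne : onLine (subst (unip z).1 (comp v i)) ≠ 0 := by
          rw [onLine_subst_unip]
          exact mul_ne_zero (C_ne_zero.2 (hz i hi)) (pow_ne_zero _ (X_ne_zero 0))
        rcases hγ with hγ | ⟨ε, hε, hκε, hγ⟩
        · obtain ⟨x, hx, hx'⟩ := exists_lim_diag hF (subst_dirMat_isHomogeneous v (some z) i) hne
            hκ (hγ i)
          refine ⟨x, ?_, by rw [hx', pow_zero, one_mul]⟩
          simpa using hx
        · obtain ⟨x, hx, hx'⟩ := exists_lim_unip hF (subst_dirMat_isHomogeneous v (some z) i) hne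
            hκ hε hκε (hγ i)
          refine ⟨x, ?_, by rw [hx', pow_zero, one_mul]⟩
          simpa using hx
      · have hzero : p.LimPoly 0 (comp (γ • w) i) := by
          rcases hγ with hγ | ⟨ε, hε, hκε, hγ⟩
          · have := hγ i
            rwa [hi, map_zero, map_zero, map_zero, mul_zero] at this
          · have := hγ i
            rwa [hi, map_zero, map_zero, map_zero, mul_zero] at this
        rw [← C_0] at hzero
        exact (hzero.unique (Place.limPoly_C (Place.lim_zero p))).trans C_0

/-- The condition on the faces of maximal dimension is sufficient. -/
theorem orbits_finite (v : Mod χ n) (hv : v ≠ 0)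
    (hcond : ∀ F, IsMaxAdmissible (polyhedron v) F → ∀ β : Fin s → ℤ,
      (∑ i ∈ faceIndices v F, β i • χ i = 0) → (∑ i ∈ faceIndices v F, β i = 0) →
        ∀ a : ℂ, ∑ i ∈ faceIndices v F, (mult v i a : ℤ) * β i = 0) :
    {O : Set (ℙ ℂ (Mod χ n)) | ∃ P ∈ zariskiClosure
      (MulAction.orbit (Grp k) (Projectivization.mk ℂ v hv)),
        O = MulAction.orbit (Grp k) P}.Finite := by
  classical
  obtain ⟨a, ha⟩ := (setOf_root_finite v).exists_notMem
  have ha' : ∀ i, comp v i ≠ 0 → (dehom (comp v i)).eval a ≠ 0 := fun i hi h => ha ⟨i, hi, h⟩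
  let orb : Mod χ n → Set (ℙ ℂ (Mod χ n)) := fun w =>
    if h : w ≠ 0 then MulAction.orbit (Grp k) (Projectivization.mk ℂ w h) else ∅
  have hT : (insert v (insert (faceLimit v Finset.univ a)
      (Set.image2 (leading v) (specialDirs v) Set.univ))).Finite :=
    ((Set.Finite.image2 _ (((setOf_root_finite v).image _).insert _)
      Set.finite_univ).insert _).insert _
  refine (Set.Finite.image2 (fun q (J : Finset (Fin s)) => orb (restrict q J)) hT
    Set.finite_univ).subset ?_
  rintro O ⟨P, hP, rfl⟩
  rw [← P.mk_rep] at hP ⊢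
  obtain ⟨q, hq, J, hne, hJ⟩ := exists_mem_orbit_restrict v hv hcond ha' _ P.rep_nonzero hP
  refine ⟨q, hq, J, trivial, ?_⟩
  simp only [orb, dif_pos hne]
  exact (MulAction.orbit_eq_iff.2 hJ).symm

end TorusSL2

theorem theorem2 {k s : ℕ} (χ : Fin s → Fin k → ℤ) (n : Fin s → ℕ)
    (v : TorusSL2.Mod χ n) (hv : v ≠ 0) :
    {O : Set (ℙ ℂ (TorusSL2.Mod χ n)) |
        ∃ P ∈ TorusSL2.zariskiClosure
            (MulAction.orbit (TorusSL2.Grp k) (Projectivization.mk ℂ v hv)),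
          O = MulAction.orbit (TorusSL2.Grp k) P}.Finite ↔
      ∀ F, TorusSL2.IsMaxAdmissible (TorusSL2.polyhedron v) F →
        ∀ β : Fin s → ℤ,
          (∑ i ∈ TorusSL2.faceIndices v F, β i • χ i = 0) →
          (∑ i ∈ TorusSL2.faceIndices v F, β i = 0) →
          ∀ a : ℂ, ∑ i ∈ TorusSL2.faceIndices v F, (TorusSL2.mult v i a : ℤ) * β i = 0 :=
  ⟨fun hfin _ hF β hβχ hβ a => TorusSL2.sum_mult_eq_zero_of_finite v hv hfin hF.1 β hβχ hβ a,
    TorusSL2.orbits_finite v hv⟩
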